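/- **Games.** A game $\langle A_1,A_2,Q,q_0,\delta,C,\mathrm{col},W\rangle$ consists of non-empty sets $A_1,A_2$ (actions of Players 1 and 2), $Q$ (states), $C$ (colors), an initial state $q_0\in Q$, maps $\delta:Q\times A_1\times A_2\to Q$ and $\mathrm{col}:Q\times A_1\times A_2\to C$, and a winning condition $W$, a set of infinite words over a set containing $C$. In each round both players choose an action concurrently; the current state $q$ and the actions $a,b$ produce the color $\mathrm{col}(q,a,b)$ and the next state $\delta(q,a,b)$. A Player 1 strategy is a map $s:A_2^*\to A_1$. It is winning if for every $\beta\in A_2^\omega$ the color sequence produced when Player 1 follows $s$ and Player 2 plays $\beta$ is in $W$. It is finite-memory if $s(h)=\sigma(q(h),m(h))$, where $q(h)$ is the state reached when Player 2 has played $h\in A_2^*$ against $s$ and $m(h)$ is in a finite set $M$ with $m(\epsilon)=m_0$ and $m(hb)=\mu(q(h),m(h),b)$. Player 1 wins (with finite memory) if she has a winning (finite-memory winning) strategy. A one-player game $\langle A_1,Q,q_0,\delta,C,\mathrm{col},W\rangle$ is the analogue without Player 2: $\delta:Q\times A_1\to Q$, $\mathrm{col}:Q\times A_1\to C$, and strategies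 are maps $\mathbb N\to A_1$. A game is finite if its sets of actions, states and colors are finite; $g_q$ denotes the game $g$ with initial state $q$. **Closure.** $W$ is closed under prefix removal if all tails of words of $W$ are in $W$. It is closed under interleaving if $u\in W$ whenever $v,w\in W$ and there are non-decreasing $l_1,l_2:\mathbb N\to\mathbb N$ with $l_1(n)+l_2(n)=n$ for all $n$ such that $u_n=v_{l_1(n)}$ if $l_1(n)<l_1(n+1)$ and $u_n=w_{l_2(n)}$ if $l_2(n)<l_2(n+1)$. **Computation steps.** Programs run on a unit-cost random-access machine (a sequential abstract state machine). Its values are natural numbers and elements of a set $\mathcal C$; its memory consists of arrays indexed by finite sequences of values, initially $0$. The unit-cost operations are constants, $+$, truncated $-$, $\times$ and integer division on naturals, equality tests, array access, access to the entries of the input, and any fixed further family of primitive operations on values. A program is a loop-free block of assignments and equality tests; one step is one execution of the block, and the block is repeated until the output cell becomes non-zero (value $1$ means "yes", any other non-zero value means "no"). The input is a finite game with $C\subseteq\mathcal C$ finite, its actions, states and colors being numbered: the input entries are the cardinalities, $q_0$, the values of $\delta$ and $\mathrm{col}$, and the list of the colors. **Statement.** Let $\mathcal C$ be a non-empty set,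 let $W\subseteq\mathcal C^\omega$ be closed under interleaving and prefix removal (resp. closed under interleaving), and let $f:\mathbb N^3\to\mathbb N$. Suppose that there is a program which, for all finite $C\subseteq\mathcal C$ and all finite one-player games $\langle A_1,Q,q_0,\delta,C,\mathrm{col},W\rangle$, decides in at most $f(|A_1|,|Q|,|C|)$ steps whether there is a winning strategy. Then there is a program which, for all finite $C\subseteq\mathcal C$ and all finite games $g_{q_0}=\langle A_1,A_2,Q,q_0,\delta,C,\mathrm{col},W\rangle$, decides in at most $$f(|A_1|,|Q|,|C|)\cdot|C\times Q|^{\,|Q|\,2^{|C\times Q|}}+|Q||A_1||A_2|$$ steps whether Player 1 wins $g_{q_0}$ (resp. a program which decides in at most $$|Q|\cdot f(|A_1|,|Q|,|C|)\cdot|C\times Q|^{\,|Q|\,2^{|C\times Q|}}+|Q||A_1||A_2|$$ steps whether Player 1 wins $g_q$ for all $q\in Q$). The same holds if, both in the assumption and in the conclusion, winning strategies are replaced by finite-memory winning strategies. -/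

import Mathlib

/-! ## Infinite words -/

/-- `u` is an interleaving of `v` and `w`: `l₁ n` and `l₂ n` letters of `v` and `w` have been
enumerated before position `n`. Only a part of one of the two words may be used up. -/
def IsInterleaving {C : Type*} (v w u : ℕ → C) : Prop :=
  ∃ l₁ l₂ : ℕ → ℕ, (∀ n, l₁ n + l₂ n = n) ∧ Monotone l₁ ∧ Monotone l₂ ∧
    (∀ n, l₁ n < l₁ (n + 1) → u n = v (l₁ n)) ∧
    (∀ n, l₂ n < l₂ (n + 1) → u n = w (l₂ n))

def ClosedUnderInterleaving {C : Type*} (W : Set (ℕ → C)) : Prop :=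
  ∀ v ∈ W, ∀ w ∈ W, ∀ u, IsInterleaving v w u → u ∈ W

def ClosedUnderPrefixRemoval {C : Type*} (W : Set (ℕ → C)) : Prop :=
  ∀ w ∈ W, ∀ m : ℕ, (fun n => w (m + n)) ∈ W

/-- The words over `C` that lie in `W`, where `C` is seen as a set of colors inside `𝒞` via `c`. -/
def restrictTo {C 𝒞 : Type*} (c : C ↪ 𝒞) (W : Set (ℕ → 𝒞)) : Set (ℕ → C) :=
  {w | (fun n => c (w n)) ∈ W}

/-! ## Concurrent games

The winning condition is passed as a separate argument `W : Set (ℕ → C)`. -/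

structure Game (A₁ A₂ Q C : Type*) where
  init : Q
  next : Q → A₁ → A₂ → Q
  col : Q → A₁ → A₂ → C

namespace Game

variable {A₁ A₂ Q C : Type*}

/-- The full history induced by a Player 1 strategy and a Player 2 history. -/
def induced (s : List A₂ → A₁) (β : List A₂) : List (A₁ × A₂) :=
  List.ofFn fun i : Fin β.length => (s (β.take i), β.get i)

theorem induced_nil (s : List A₂ → A₁) : induced s [] = [] := rfl

theorem induced_snoc (s : List A₂ → A₁) (β : List A₂) (b : A₂) :
    induced s (β ++ [b]) = induced s β ++ [(s β, b)] := by
  apply List.ext_getElem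
  · simp [induced]
  · intro i h₁ h₂
    have hi : i < β.length + 1 := by simpa [induced] using h₁
    rcases Nat.lt_succ_iff_lt_or_eq.mp hi with h | h
    · rw [List.getElem_append_left (by simpa [induced] using h)]
      simp only [induced, List.getElem_ofFn, List.get_eq_getElem, List.getElem_append_left h,
        List.take_append_of_le_length h.le]
    · subst h
      rw [List.getElem_append_right (by simp [induced])]
      simp only [induced, List.getElem_ofFn, List.get_eq_getElem]
      simp

/-- The state reached after a full history. -/
def stateAfter (G : Game A₁ A₂ Q C) (ρ : List (A₁ × A₂)) : Q :=
  ρ.foldl (fun q ab => G.next q ab.1 ab.2) G.init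

/-- The color sequence produced when Player 1 follows `s` and Player 2 plays the run `β`. -/
def trace (G : Game A₁ A₂ Q C) (s : List A₂ → A₁) (β : ℕ → A₂) : ℕ → C := fun n =>
  let h := List.ofFn fun i : Fin n => β i
  G.col (G.stateAfter (induced s h)) (s h) (β n)

def IsWinning (G : Game A₁ A₂ Q C) (W : Set (ℕ → C)) (s : List A₂ → A₁) : Prop :=
  ∀ β : ℕ → A₂, G.trace s β ∈ W

def IsFiniteMemory (G : Game A₁ A₂ Q C) (s : List A₂ → A₁) : Prop :=
  ∃ (M : Type) (_ : Finite M) (m₀ : M) (σ : Q → M → A₁) (μ : Q → M → A₂ → M) (m : List A₂ → M),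
    m [] = m₀ ∧
    (∀ β b, m (β ++ [b]) = μ (G.stateAfter (induced s β)) (m β) b) ∧
    ∀ β, s β = σ (G.stateAfter (induced s β)) (m β)

/-- Player 1 has a winning strategy. -/
def Wins (G : Game A₁ A₂ Q C) (W : Set (ℕ → C)) : Prop :=
  ∃ s, G.IsWinning W s

/-- Player 1 has a finite-memory winning strategy. -/
def WinsFM (G : Game A₁ A₂ Q C) (W : Set (ℕ → C)) : Prop :=
  ∃ s, G.IsWinning W s ∧ G.IsFiniteMemory s

/-- The same game, started at `q`. -/
def startAt (G : Game A₁ A₂ Q C) (q : Q) : Game A₁ A₂ Q C :=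
  { G with init := q }

end Game

/-! ## One-player games -/

structure OnePlayerGame (A Q C : Type*) where
  init : Q
  next : Q → A → Q
  col : Q → A → C

namespace OnePlayerGame

variable {A Q C : Type*}

/-- The state reached after a full history. -/
def stateAfter (G : OnePlayerGame A Q C) (ρ : List A) : Q :=
  ρ.foldl G.next G.init

/-- The state reached after `n` rounds played according to the strategy `s`. -/
def stateAt (G : OnePlayerGame A Q C) (s : ℕ → A) (n : ℕ) : Q :=
  G.stateAfter (List.ofFn fun i : Fin n => s i)

def trace (G : OnePlayerGame A Q C) (s : ℕ → A) : ℕ → C := fun n =>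
  G.col (G.stateAt s n) (s n)

def IsWinning (G : OnePlayerGame A Q C) (W : Set (ℕ → C)) (s : ℕ → A) : Prop :=
  G.trace s ∈ W

def IsFiniteMemory (G : OnePlayerGame A Q C) (s : ℕ → A) : Prop :=
  ∃ (M : Type) (_ : Finite M) (m₀ : M) (σ : Q → M → A) (μ : Q → M → M) (m : ℕ → M),
    m 0 = m₀ ∧ (∀ n, m (n + 1) = μ (G.stateAt s n) (m n)) ∧ ∀ n, s n = σ (G.stateAt s n) (m n)

def Wins (G : OnePlayerGame A Q C) (W : Set (ℕ → C)) : Prop :=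
  ∃ s, G.IsWinning W s

def WinsFM (G : OnePlayerGame A Q C) (W : Set (ℕ → C)) : Prop :=
  ∃ s, G.IsWinning W s ∧ G.IsFiniteMemory s

end OnePlayerGame

/-! ## The computation model

A unit-cost random-access machine, in the format of a sequential abstract state machine.
Values are natural numbers and colors. The memory consists of arrays that are indexed by
finite sequences of values; all cells initially hold the number `0`.
A program is one loop-free block of commands; one computation step executes this block once, so
that one step does a bounded amount of work, with a bound that depends only on the program.
Loops arise by iterating the block until the machine halts. -/

abbrev Value (𝒞 : Type*) := ℕ ⊕ 𝒞

/-- The symbols through which a program reads its input. -/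
inductive InputSym
  | numA₁ | numA₂ | numQ | numC | start | next | col | color

/-- A read-only input: its entry for a symbol and a sequence of arguments. -/
abbrev Input (𝒞 : Type*) := InputSym → List (Value 𝒞) → Value 𝒞

/-- Additional unit-cost primitive operations on numbers and colors, e.g. arithmetic on colors. -/
abbrev Primitives (𝒞 : Type*) := ℕ → List (Value 𝒞) → Value 𝒞

abbrev Memory (𝒞 : Type*) := ℕ → List (Value 𝒞) → Value 𝒞

inductive ArithOp
  | add | sub | mul | div

/-- Operations of truncated arithmetic on natural numbers; `0` if an operand is a color. -/
def ArithOp.eval {𝒞 : Type*} : ArithOp → Value 𝒞 → Value 𝒞 → Value 𝒞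
  | .add, .inl x, .inl y => .inl (x + y)
  | .sub, .inl x, .inl y => .inl (x - y)
  | .mul, .inl x, .inl y => .inl (x * y)
  | .div, .inl x, .inl y => .inl (x / y)
  | _, _, _ => .inl 0

inductive Term : Type
  | const (n : ℕ)
  | arith (o : ArithOp) (s t : Term)
  | prim (p k : ℕ) (args : Fin k → Term)
  | input (i : InputSym) (k : ℕ) (args : Fin k → Term)
  | read (x k : ℕ) (args : Fin k → Term)

def Term.eval {𝒞 : Type*} (B : Primitives 𝒞) (I : Input 𝒞) (m : Memory 𝒞) : Term → Value 𝒞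
  | .const n => .inl n
  | .arith o s t => o.eval (s.eval B I m) (t.eval B I m)
  | .prim p _ args => B p (List.ofFn fun j => (args j).eval B I m)
  | .input i _ args => I i (List.ofFn fun j => (args j).eval B I m)
  | .read x _ args => m x (List.ofFn fun j => (args j).eval B I m)

/-- Loop-free blocks; `ifEq s t c d` executes `c` if `s` and `t` have equal values, and `d`
otherwise. -/
inductive Block : Type
  | skip
  | write (x k : ℕ) (args : Fin k → Term) (t : Term)
  | seq (c d : Block)
  | ifEq (s t : Term) (c d : Block)

open Classical in
noncomputable def Block.exec {𝒞 : Type*} (B : Primitives 𝒞) (I : Input 𝒞) :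
    Block → Memory 𝒞 → Memory 𝒞
  | .skip, m => m
  | .write x _ args t, m => fun y l =>
      if y = x ∧ l = List.ofFn (fun j => (args j).eval B I m) then t.eval B I m else m y l
  | .seq c d, m => d.exec B I (c.exec B I m)
  | .ifEq s t c d, m => if s.eval B I m = t.eval B I m then c.exec B I m else d.exec B I m

/-- The memory after `n` computation steps on input `I`. -/
noncomputable def Block.run {𝒞 : Type*} (P : Block) (B : Primitives 𝒞) (I : Input 𝒞) (n : ℕ) :
    Memory 𝒞 :=
  (P.exec B I)^[n] fun _ _ => .inl 0

/-- The output cell: `0` as long as the machine is running, `1` for the answer "yes", and any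
other value for the answer "no". -/
noncomputable def Block.output {𝒞 : Type*} (P : Block) (B : Primitives 𝒞) (I : Input 𝒞) (n : ℕ) :
    Value 𝒞 :=
  P.run B I n 0 []

/-- The program `P` halts on input `I` after at most `T` steps, and it answers "yes" iff `p`. -/
def Block.Decides {𝒞 : Type*} (P : Block) (B : Primitives 𝒞) (I : Input 𝒞) (p : Prop) (T : ℕ) :
    Prop :=
  ∃ t ≤ T, (∀ u < t, P.output B I u = .inl 0) ∧ P.output B I t ≠ .inl 0 ∧
    (P.output B I t = .inl 1 ↔ p)

/-! ## Finite games as inputs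

Actions, states and colors of a finite game are numbered, and `c` is the list of its colors.
Entries with a wrong number of arguments or with arguments out of range are `0`. -/

/-- `x` if `x < n`. -/
def toFin? {𝒞 : Type*} (n : ℕ) : Value 𝒞 → Option (Fin n)
  | .inl x => if h : x < n then some ⟨x, h⟩ else none
  | .inr _ => none

def OnePlayerGame.toInput {𝒞 : Type*} {a n k : ℕ} (G : OnePlayerGame (Fin a) (Fin n) (Fin k))
    (c : Fin k ↪ 𝒞) : Input 𝒞
  | .numA₁, [] => .inl a
  | .numA₂, [] => .inl 1
  | .numQ, [] => .inl n
  | .numC, [] => .inl k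
  | .start, [] => .inl G.init
  | .next, [x, y] =>
      match toFin? n x, toFin? a y with
      | some q, some i => .inl (G.next q i)
      | _, _ => .inl 0
  | .col, [x, y] =>
      match toFin? n x, toFin? a y with
      | some q, some i => .inl (G.col q i)
      | _, _ => .inl 0
  | .color, [x] =>
      match toFin? k x with
      | some i => .inr (c i)
      | none => .inl 0
  | _, _ => .inl 0

def Game.toInput {𝒞 : Type*} {a₁ a₂ n k : ℕ} (G : Game (Fin a₁) (Fin a₂) (Fin n) (Fin k))
    (c : Fin k ↪ 𝒞) : Input 𝒞
  | .numA₁, [] => .inl a₁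
  | .numA₂, [] => .inl a₂
  | .numQ, [] => .inl n
  | .numC, [] => .inl k
  | .start, [] => .inl G.init
  | .next, [x, y, z] =>
      match toFin? n x, toFin? a₁ y, toFin? a₂ z with
      | some q, some i, some j => .inl (G.next q i j)
      | _, _, _ => .inl 0
  | .col, [x, y, z] =>
      match toFin? n x, toFin? a₁ y, toFin? a₂ z with
      | some q, some i, some j => .inl (G.col q i j)
      | _, _, _ => .inl 0
  | .color, [x] =>
      match toFin? k x with
      | some i => .inr (c i)
      | none => .inl 0
  | _, _ => .inl 0

/-- It takes `P` at most `f |A₁| |Q| |C|` steps to decide whether the player has a winning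
strategy, in all finite one-player games with colors in `𝒞` and winning condition `W`. -/
def DecidesOnePlayer {𝒞 : Type*} (B : Primitives 𝒞) (W : Set (ℕ → 𝒞)) (f : ℕ → ℕ → ℕ → ℕ)
    (P : Block) : Prop :=
  ∀ (a n k : ℕ) (_ : 0 < a) (c : Fin k ↪ 𝒞) (G : OnePlayerGame (Fin a) (Fin n) (Fin k)),
    P.Decides B (G.toInput c) (G.Wins (restrictTo c W)) (f a n k)

/-- The same for finite-memory winning strategies. -/
def DecidesOnePlayerFM {𝒞 : Type*} (B : Primitives 𝒞) (W : Set (ℕ → 𝒞)) (f : ℕ → ℕ → ℕ → ℕ)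
    (P : Block) : Prop :=
  ∀ (a n k : ℕ) (_ : 0 < a) (c : Fin k ↪ 𝒞) (G : OnePlayerGame (Fin a) (Fin n) (Fin k)),
    P.Decides B (G.toInput c) (G.WinsFM (restrictTo c W)) (f a n k)

/-! ## Interleaving and tails of restricted winning conditions -/

/-! Fix a positional response of Player 2, and the game becomes a one-player game. Player 1 wins if
and only if she wins all these one-player games, and it suffices to test responses whose move (a
color and a next state) depends only on the state and on the set of moves left open by her action.
This set serves as the label of the action. There are at most |C × Q| ^ (|Q| 2 ^ |C × Q|) such
choices, whatever the number of actions.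

The hard direction is an induction on the option sets of Player 2 (`SplitsAt.induction`). Split the
options at one pair (q₀, l₀) into two parts, let `S₁` win against the first part, and let `S₂` win
against the second part from q₀. Play `S₁` until it is about to play l₀ in q₀, then play `S₂` until
it is about to do the same; the answer of Player 2 decides which of the two continues. The colors
interleave a play of `S₁` and a play of `S₂` (`Winnable.merge`). Since `S₂` has to start in q₀, the
induction runs over all initial states at once. Under closure under prefix removal one initial state
suffices: if q₀ is lost against the second part, then a winner against this part never visits q₀ and
does not notice the split (`Winnable.merge_of_prefixRemoval`).

For the time bound, one step is spent on each triple of a state and two actions. Moves get powers of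
two as weights, so that a sum codes a set of moves, and each pair of a state and a set that occurs
gets a place value in base |C × Q|. The number of a run, read in this base, is then a response
(`Tables.Invariant.isRich_response`). One step of the given program is simulated in one step: a
response is computed by a bounded number of operations, each run owns fresh memory, and passing to
the next run is part of the last step of a run (`Decider.decidesFrom_run`). -/

theorem ClosedUnderInterleaving.restrictTo {C 𝒞 : Type*} {W : Set (ℕ → 𝒞)}
    (hW : ClosedUnderInterleaving W) (c : C ↪ 𝒞) :
    ClosedUnderInterleaving (restrictTo c W) := by
  rintro v hv w hw u ⟨l₁, l₂, hl, h₁, h₂, hv', hw'⟩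
  exact hW _ hv _ hw _ ⟨l₁, l₂, hl, h₁, h₂, fun n hn => congrArg c (hv' n hn),
    fun n hn => congrArg c (hw' n hn)⟩

theorem ClosedUnderPrefixRemoval.restrictTo {C 𝒞 : Type*} {W : Set (ℕ → 𝒞)}
    (hW : ClosedUnderPrefixRemoval W) (c : C ↪ 𝒞) :
    ClosedUnderPrefixRemoval (restrictTo c W) :=
  fun _ hw m => hW _ hw m

/-! ## Winning strategies with or without a memory restriction -/

/-- The proposition `fm` switches the memory restriction on or off, so that one proof serves both
halves of the main theorem. -/
def Game.WinsWith {A₁ A₂ Q C : Type*} (fm : Prop) (G : Game A₁ A₂ Q C) (W : Set (ℕ → C)) : Prop :=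
  ∃ s, G.IsWinning W s ∧ (fm → G.IsFiniteMemory s)

def OnePlayerGame.WinsWith {A Q C : Type*} (fm : Prop) (G : OnePlayerGame A Q C)
    (W : Set (ℕ → C)) : Prop :=
  ∃ s, G.IsWinning W s ∧ (fm → G.IsFiniteMemory s)

/-! ## Controllers

A strategy of Player 1, presented as an automaton that reads the moves of Player 2. A move of
Player 1 is a label `l : L`; Player 2 answers with a color and a state from a set `opt q l`. -/

structure Controller (Q C L : Type*) where
  M : Type
  state : M → Q
  act : M → L
  upd : M → C × Q → M
  state_upd : ∀ m e, state (upd m e) = e.2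

namespace Controller

variable {Q C L : Type*}

def opts (S : Controller Q C L) (opt : Q → L → Finset (C × Q)) (m : S.M) : Finset (C × Q) :=
  opt (S.state m) (S.act m)

def IsPlay (S : Controller Q C L) (opt : Q → L → Finset (C × Q)) (m : ℕ → S.M) (e : ℕ → C × Q) :
    Prop :=
  ∀ n, e n ∈ S.opts opt (m n) ∧ m (n + 1) = S.upd (m n) (e n)

def Wins (S : Controller Q C L) (opt : Q → L → Finset (C × Q)) (W : Set (ℕ → C)) (m₀ : S.M) :
    Prop :=
  ∀ m e, m 0 = m₀ → S.IsPlay opt m e → (fun n => (e n).1) ∈ W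

/-- A controller that makes a legal move or pauses in every round can be driven through a play
in which its `k`-th legal move is the `k`-th move. -/
theorem exists_isPlay_of_pausing (S : Controller Q C L) {opt : Q → L → Finset (C × Q)}
    (hne : ∀ q l, (opt q l).Nonempty) (J : ℕ → Prop) [DecidablePred J] (x : ℕ → S.M)
    (e : ℕ → C × Q) (hJ : ∀ n, J n → e n ∈ S.opts opt (x n) ∧ x (n + 1) = S.upd (x n) (e n))
    (hJ' : ∀ n, ¬ J n → x (n + 1) = x n) :
    ∃ x' e', x' 0 = x 0 ∧ S.IsPlay opt x' e' ∧ ∀ n, J n → e' (Nat.count J n) = e n := by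
  classical
  choose pick hpick using fun m : S.M => hne (S.state m) (S.act m)
  -- If the controller moves only finitely often, the play is continued by arbitrary legal answers
  -- `pick`; an interleaving may leave this continuation unused.
  let edge : ℕ → S.M → C × Q := fun k m =>
    if h : ∃ n, J n ∧ Nat.count J n = k then e h.choose else pick m
  have hedge : ∀ n, J n → ∀ m, edge (Nat.count J n) m = e n := by
    intro n hn m
    have h : ∃ n', J n' ∧ Nat.count J n' = Nat.count J n := ⟨n, hn, rfl⟩
    have h' : h.choose = n := Nat.count_injective h.choose_spec.1 hn h.choose_spec.2
    simp only [edge, dif_pos h, h']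
  let x' : ℕ → S.M := fun k => Nat.rec (x 0) (fun k m => S.upd m (edge k m)) k
  have hx : ∀ n, x' (Nat.count J n) = x n := by
    intro n
    induction n with
    | zero => simp [x']
    | succ n ih =>
      by_cases hn : J n
      · rw [Nat.count_succ, if_pos hn, (hJ n hn).2, ← ih]
        change S.upd _ (edge _ _) = _
        rw [hedge n hn]
      · rw [Nat.count_succ, if_neg hn, hJ' n hn, ← ih, Nat.add_zero]
  refine ⟨x', fun k => edge k (x' k), rfl, fun k => ⟨?_, rfl⟩, fun n hn => hedge n hn _⟩
  by_cases h : ∃ n, J n ∧ Nat.count J n = k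
  · obtain ⟨n, hn, rfl⟩ := h
    simp only [hedge n hn, hx]
    exact (hJ n hn).1
  · simp only [edge, dif_neg h]
    exact hpick _

/-- A play from the updated memory becomes a play from `m₀` when `e₀` is put in front; prefix
removal deletes its first color again. -/
theorem Wins.upd {S : Controller Q C L} {opt : Q → L → Finset (C × Q)} {W : Set (ℕ → C)}
    (hW : ClosedUnderPrefixRemoval W) {m₀ : S.M} (h : S.Wins opt W m₀) {e₀ : C × Q}
    (he₀ : e₀ ∈ S.opts opt m₀) : S.Wins opt W (S.upd m₀ e₀) := by
  intro m e hm he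
  have := hW _ (h (fun n => Nat.casesOn n m₀ m) (fun n => Nat.casesOn n e₀ e) rfl
    (fun n => by cases n with
      | zero => exact ⟨he₀, hm⟩
      | succ n => exact he n)) 1
  simpa [Nat.add_comm 1] using this

end Controller

/-- From the state `p`, Player 1 has a winning controller whose moves are available, and which is
finite if `fm` holds. -/
def Winnable {Q C L : Type*} (fm : Prop) (avail : Q → Set L) (W : Set (ℕ → C))
    (opt : Q → L → Finset (C × Q)) (p : Q) : Prop :=
  ∃ S : Controller Q C L, (fm → Finite S.M) ∧ (∀ m, S.act m ∈ avail (S.state m)) ∧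
    ∃ m₀, S.state m₀ = p ∧ S.Wins opt W m₀

/-! ### Splitting the options of Player 2 and merging controllers -/

section Splitting

variable {Q C L : Type*} {fm : Prop} {avail : Q → Set L} {W : Set (ℕ → C)}

/-- `opt` differs from `opt₁` and `opt₂` at most at `(q₀, l₀)`, where its options are
distributed over both. -/
structure SplitsAt (opt opt₁ opt₂ : Q → L → Finset (C × Q)) (q₀ : Q) (l₀ : L) : Prop where
  left : ∀ q l, ¬ (q = q₀ ∧ l = l₀) → opt₁ q l = opt q l
  right : ∀ q l, ¬ (q = q₀ ∧ l = l₀) → opt₂ q l = opt q l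
  mem_or_mem : ∀ e ∈ opt q₀ l₀, e ∈ opt₁ q₀ l₀ ∨ e ∈ opt₂ q₀ l₀
  left_nonempty : ∀ q l, (opt₁ q l).Nonempty
  right_nonempty : ∀ q l, (opt₂ q l).Nonempty

open Classical in
/-- The controller that pauses `S₁` and `S₂` at the critical position `(q₀, l₀)` and resumes the
one for which the next move of Player 2 is legal. -/
noncomputable def Controller.merge (S₁ S₂ : Controller Q C L) (q₀ : Q) (l₀ : L)
    (X : Finset (C × Q)) : Controller Q C L where
  M := {z : S₁.M × S₂.M // (S₁.state z.1 = q₀ ∧ S₁.act z.1 = l₀) ∨ S₂.state z.2 = q₀}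
  state z := if S₁.state z.1.1 = q₀ ∧ S₁.act z.1.1 = l₀ then S₂.state z.1.2 else S₁.state z.1.1
  act z := if S₁.state z.1.1 = q₀ ∧ S₁.act z.1.1 = l₀ then S₂.act z.1.2 else S₁.act z.1.1
  upd z e :=
    if h : S₁.state z.1.1 = q₀ ∧ S₁.act z.1.1 = l₀ then
      if h' : (S₂.state z.1.2 = q₀ ∧ S₂.act z.1.2 = l₀) ∧ e ∈ X then
        ⟨(S₁.upd z.1.1 e, z.1.2), Or.inr h'.1.1⟩
      else ⟨(z.1.1, S₂.upd z.1.2 e), Or.inl h⟩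
    else ⟨(S₁.upd z.1.1 e, z.1.2), Or.inr (z.2.resolve_left h)⟩
  state_upd z e := by
    have he₁ := S₁.state_upd z.1.1 e
    have he₂ := S₂.state_upd z.1.2 e
    have hz := z.2
    -- If the move makes `S₁` critical, then control passes to `S₂`, which has been waiting in `q₀`,
    -- the very state that `S₁` has just reached.
    split_ifs with h₁ h₂ h₃ h₃ <;>
      first
      | exact (hz.resolve_left h₁).trans (h₃.1.symm.trans he₁)
      | simp_all

/-- Each controller sees only answers from its own option sets: `S₁` leaves the critical position
only by an answer in `opt₁`, and `S₂` only by one outside `opt₁`, hence in `opt₂`. The two color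
sequences are then in `W`, and so is their interleaving. -/
theorem Winnable.merge (hW : ClosedUnderInterleaving W) {opt opt₁ opt₂ : Q → L → Finset (C × Q)}
    {q₀ : Q} {l₀ : L} (hs : SplitsAt opt opt₁ opt₂ q₀ l₀) {p : Q}
    (h₁ : Winnable fm avail W opt₁ p) (h₂ : Winnable fm avail W opt₂ q₀) :
    Winnable fm avail W opt p := by
  classical
  obtain ⟨S₁, hfin₁, hav₁, m₁, hm₁, hwin₁⟩ := h₁
  obtain ⟨S₂, hfin₂, hav₂, m₂, hm₂, hwin₂⟩ := h₂
  let S := S₁.merge S₂ q₀ l₀ (opt₁ q₀ l₀)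
  refine ⟨S, fun h => ?_, fun m => ?_, ⟨(m₁, m₂), Or.inr hm₂⟩, ?_, ?_⟩
  · have := hfin₁ h
    have := hfin₂ h
    exact Subtype.finite
  · change (if _ then _ else _) ∈ avail (if _ then _ else _)
    split_ifs
    · exact hav₂ _
    · exact hav₁ _
  · change (if _ then _ else _) = _
    split_ifs with h
    · exact hm₂.trans (h.1.symm.trans hm₁)
    · exact hm₁
  · intro m e hm hplay
    let c₁ : ℕ → Prop := fun n => S₁.state (m n).1.1 = q₀ ∧ S₁.act (m n).1.1 = l₀
    let c₂ : ℕ → Prop := fun n => S₂.state (m n).1.2 = q₀ ∧ S₂.act (m n).1.2 = l₀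
    -- `J n` says that `S₁` moves in round `n`; in all other rounds `S₂` moves.
    let J : ℕ → Prop := fun n => c₁ n → c₂ n ∧ e n ∈ opt₁ q₀ l₀
    have hleg : ∀ n, e n ∈ (if c₁ n then S₂.opts opt (m n).1.2 else S₁.opts opt (m n).1.1) := by
      intro n
      have := (hplay n).1
      change e n ∈ opt (if c₁ n then _ else _) (if c₁ n then _ else _) at this
      split_ifs at this ⊢
      · exact this
      · exact this
    have hJ : ∀ n, J n → (m (n + 1)).1 = (S₁.upd (m n).1.1 (e n), (m n).1.2) := by
      intro n hn
      rw [(hplay n).2]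
      by_cases h : c₁ n
      · simp only [S, Controller.merge]
        rw [dif_pos h, dif_pos (hn h)]
      · simp only [S, Controller.merge]
        rw [dif_neg h]
    have hJ' : ∀ n, ¬ J n → (m (n + 1)).1 = ((m n).1.1, S₂.upd (m n).1.2 (e n)) := by
      intro n hn
      rw [(hplay n).2]
      obtain ⟨h, h'⟩ := Classical.not_imp.mp hn
      simp only [S, Controller.merge]
      rw [dif_pos h, dif_neg h']
    obtain ⟨x, v, hx, hxv, hv⟩ := S₁.exists_isPlay_of_pausing hs.left_nonempty J
      (fun n => (m n).1.1) e
      (fun n hn => ⟨by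
        have := hleg n
        by_cases h : c₁ n
        · simp only [Controller.opts]
          rw [h.1, h.2]
          exact (hn h).2
        · rw [if_neg h] at this
          simp only [Controller.opts]
          rw [hs.left _ _ h]
          exact this, by simp only [hJ n hn]⟩)
      (fun n hn => by simp only [hJ' n hn])
    obtain ⟨y, w, hy, hyw, hw⟩ := S₂.exists_isPlay_of_pausing hs.right_nonempty (fun n => ¬ J n)
      (fun n => (m n).1.2) e
      (fun n hn => ⟨by
        have := hleg n
        obtain ⟨h, h'⟩ := Classical.not_imp.mp hn
        rw [if_pos h] at this
        simp only [Controller.opts] at this ⊢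
        by_cases h₂ : c₂ n
        · rw [h₂.1, h₂.2] at this ⊢
          exact (hs.mem_or_mem _ this).resolve_left fun h₃ => h' ⟨h₂, h₃⟩
        · rw [hs.right _ _ h₂]
          exact this, by simp only [hJ' n hn]⟩)
      (fun n hn => by simp only [hJ n (not_not.mp hn)])
    -- The interleaving is given by the numbers of earlier rounds with and without `J`.
    refine hW _ (hwin₁ x v (by rw [hx, hm]) hxv) _ (hwin₂ y w (by rw [hy, hm]) hyw) _
      ⟨Nat.count J, Nat.count (fun n => ¬ J n), fun n => ?_, Nat.count_monotone _,
        Nat.count_monotone _, fun n hn => ?_, fun n hn => ?_⟩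
    · induction n with
      | zero => simp
      | succ n ih => rw [Nat.count_succ, Nat.count_succ]; split_ifs <;> omega
    · rw [Nat.count_lt_count_succ_iff] at hn
      simp only [hv n hn]
    · rw [Nat.count_lt_count_succ_iff] at hn
      simp only [hw n hn]

/-- If `q₀` is winnable against `opt₂`, merging applies. Otherwise, as winning survives legal moves,
the winner against `opt₂` from `p` never reaches `q₀`, the only state where `opt` and `opt₂` differ.
-/
theorem Winnable.merge_of_prefixRemoval (hW : ClosedUnderInterleaving W)
    (hW' : ClosedUnderPrefixRemoval W) {opt opt₁ opt₂ : Q → L → Finset (C × Q)}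
    {q₀ : Q} {l₀ : L} (hs : SplitsAt opt opt₁ opt₂ q₀ l₀) {p : Q}
    (h₁ : Winnable fm avail W opt₁ p) (h₂ : Winnable fm avail W opt₂ p) :
    Winnable fm avail W opt p := by
  by_cases h : Winnable fm avail W opt₂ q₀
  · exact h₁.merge hW hs h
  obtain ⟨S, hfin, hav, m₀, hm₀, hwin⟩ := h₂
  have hq : ∀ m, S.Wins opt₂ W m → S.opts opt m = S.opts opt₂ m := fun m hm =>
    (hs.right _ _ fun h' => h ⟨S, hfin, hav, m, h'.1, hm⟩).symm
  refine ⟨S, hfin, hav, m₀, hm₀, fun m e hm hplay => ?_⟩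
  have hall : ∀ n, S.Wins opt₂ W (m n) := by
    intro n
    induction n with
    | zero => rwa [hm]
    | succ n ih =>
      rw [(hplay n).2]
      exact ih.upd hW' (hq _ ih ▸ (hplay n).1)
  exact hwin m e hm fun n => ⟨hq _ (hall n) ▸ (hplay n).1, (hplay n).2⟩

/-- Option sets decrease under inclusion until all are singletons, which are choice functions. A
choice from smaller sets is also a choice from the original ones, so `single` passes down the
induction. -/
theorem SplitsAt.induction [Finite Q] [Finite L] {X : (Q → L → Finset (C × Q)) → Prop}
    (split : ∀ opt opt₁ opt₂ q₀ l₀, SplitsAt opt opt₁ opt₂ q₀ l₀ → X opt₁ → X opt₂ → X opt)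
    (opt : Q → L → Finset (C × Q)) (hne : ∀ q l, (opt q l).Nonempty)
    (single : ∀ τ : Q → L → C × Q, (∀ q l, τ q l ∈ opt q l) → X fun q l => {τ q l}) : X opt := by
  classical
  induction opt using WellFoundedLT.induction with
  | ind opt ih =>
    by_cases h : ∀ q l, ∃ e, opt q l = {e}
    · choose τ hτ using h
      rw [show opt = fun q l => {τ q l} from funext fun q => funext fun l => hτ q l]
      exact single τ fun q l => by simp [hτ]
    · push Not at h
      obtain ⟨q₀, l₀, h⟩ := h
      obtain ⟨e, he⟩ := hne q₀ l₀
      let upd : Finset (C × Q) → Q → L → Finset (C × Q) := fun Y q l =>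
        if q = q₀ ∧ l = l₀ then Y else opt q l
      have hupd : ∀ Y, upd Y q₀ l₀ = Y := fun Y => if_pos ⟨rfl, rfl⟩
      have hupd' : ∀ Y q l, ¬ (q = q₀ ∧ l = l₀) → upd Y q l = opt q l := fun Y q l h => if_neg h
      have hsub : ∀ Y ⊆ opt q₀ l₀, ∀ q l, upd Y q l ⊆ opt q l := by
        intro Y hY q l
        by_cases hql : q = q₀ ∧ l = l₀
        · rw [hql.1, hql.2, hupd]; exact hY
        · rw [hupd' _ _ _ hql]
      have hne' : ∀ Y : Finset (C × Q), Y.Nonempty → ∀ q l, (upd Y q l).Nonempty := by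
        intro Y hY q l
        by_cases hql : q = q₀ ∧ l = l₀
        · rw [hql.1, hql.2, hupd]; exact hY
        · rw [hupd' _ _ _ hql]; exact hne q l
      have key : ∀ Y ⊂ opt q₀ l₀, Y.Nonempty → X (upd Y) := by
        intro Y hY hYne
        refine ih (upd Y) (lt_of_le_of_ne (hsub Y hY.1) fun heq => hY.ne ?_) (hne' Y hYne)
          fun τ hτ => single τ fun q l => hsub Y hY.1 q l (hτ q l)
        rw [← hupd Y, heq]
      have h₂ : ((opt q₀ l₀).erase e).Nonempty := by
        rw [Finset.nonempty_iff_ne_empty]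
        intro h₂
        rcases (Finset.erase_eq_empty_iff _ _).mp h₂ with h₂ | h₂
        · simp [h₂] at he
        · exact h e h₂
      -- A set that is not a singleton splits into one element and the rest, both proper and
      -- non-empty.
      refine split opt (upd {e}) (upd ((opt q₀ l₀).erase e)) q₀ l₀
        ⟨hupd' _, hupd' _, fun e' he' => ?_, hne' _ (Finset.singleton_nonempty e), hne' _ h₂⟩
        (key _ ?_ (Finset.singleton_nonempty e)) (key _ (Finset.erase_ssubset he) h₂)
      · rw [hupd, hupd]
        by_cases hee : e' = e
        · simp [hee]
        · simp [hee, he']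
      · exact ⟨by simpa using he, fun hle => h e (Finset.Subset.antisymm hle (by simpa using he))⟩

theorem Winnable.of_forall_choice [Finite Q] [Finite L] (hW : ClosedUnderInterleaving W)
    {opt : Q → L → Finset (C × Q)} (hne : ∀ q l, (opt q l).Nonempty)
    (h : ∀ τ : Q → L → C × Q, (∀ q l, τ q l ∈ opt q l) →
      ∀ p, Winnable fm avail W (fun q l => {τ q l}) p) (p : Q) :
    Winnable fm avail W opt p :=
  -- The quantifier over `p` belongs to the induction hypothesis, because merging uses the second
  -- controller from `q₀`.
  SplitsAt.induction (X := fun opt => ∀ p, Winnable fm avail W opt p)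
    (fun _ _ _ _ _ hs h₁ h₂ p => (h₁ p).merge hW hs (h₂ _)) opt hne h p

theorem Winnable.of_forall_choice_of_prefixRemoval [Finite Q] [Finite L]
    (hW : ClosedUnderInterleaving W) (hW' : ClosedUnderPrefixRemoval W)
    {opt : Q → L → Finset (C × Q)} (hne : ∀ q l, (opt q l).Nonempty) {p : Q}
    (h : ∀ τ : Q → L → C × Q, (∀ q l, τ q l ∈ opt q l) →
      Winnable fm avail W (fun q l => {τ q l}) p) :
    Winnable fm avail W opt p :=
  SplitsAt.induction (X := fun opt => Winnable fm avail W opt p)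
    (fun _ _ _ _ _ hs h₁ h₂ => h₁.merge_of_prefixRemoval hW hW' hs h₂) opt hne h

end Splitting

/-! ## From controllers to games -/

namespace Game

variable {A₁ A₂ Q C : Type*}

/-- The one-player game in which Player 2 has fixed a positional response. -/
def against (G : Game A₁ A₂ Q C) (β : Q → A₁ → A₂) : OnePlayerGame A₁ Q C where
  init := G.init
  next q a := G.next q a (β q a)
  col q a := G.col q a (β q a)

def move (G : Game A₁ A₂ Q C) (q : Q) (a : A₁) (b : A₂) : C × Q := (G.col q a b, G.next q a b)

theorem stateAfter_snoc (G : Game A₁ A₂ Q C) (ρ : List (A₁ × A₂)) (ab : A₁ × A₂) :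
    G.stateAfter (ρ ++ [ab]) = G.next (G.stateAfter ρ) ab.1 ab.2 := by
  simp [stateAfter]

theorem stateAfter_induced_snoc (G : Game A₁ A₂ Q C) (s : List A₂ → A₁) (h : List A₂) (b : A₂) :
    G.stateAfter (induced s (h ++ [b])) = G.next (G.stateAfter (induced s h)) (s h) b := by
  rw [induced_snoc, stateAfter_snoc]

theorem ofFn_prefix_succ (β : ℕ → A₂) (n : ℕ) :
    (List.ofFn fun i : Fin (n + 1) => β i) = (List.ofFn fun i : Fin n => β i) ++ [β n] := by
  rw [List.ofFn_succ_last]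
  rfl

/-- The set of moves among which Player 2 chooses when Player 1 plays `a` in the state `q`. -/
noncomputable def moves [Fintype A₂] [Nonempty A₂] (G : Game A₁ A₂ Q C) (q : Q) (a : A₁) :
    {S : Finset (C × Q) // S.Nonempty} :=
  open Classical in ⟨Finset.univ.image (G.move q a), Finset.univ_nonempty.image _⟩

variable {fm : Prop} {W : Set (ℕ → C)}

theorem mem_moves [Fintype A₂] [Nonempty A₂] {G : Game A₁ A₂ Q C} {q : Q} {a : A₁} {e : C × Q} :
    e ∈ (G.moves q a).1 ↔ ∃ b, G.move q a b = e := by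
  simp [moves]

/-- Availability of the labels lets an action be chosen for each memory state. Player 2's action is
passed to the controller as the move that it causes. -/
theorem winsWith_of_winnable [Fintype A₂] [Nonempty A₂] (G : Game A₁ A₂ Q C)
    (h : Winnable fm (fun q => Set.range (G.moves q)) W (fun _ l => l.1) G.init) :
    G.WinsWith fm W := by
  obtain ⟨S, hfin, hav, m₀, hm₀, hwin⟩ := h
  choose a ha using hav
  let upd : S.M → A₂ → S.M := fun m b => S.upd m (G.move (S.state m) (a m) b)
  let mem : List A₂ → S.M := List.foldl upd m₀
  let s : List A₂ → A₁ := fun h => a (mem h)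
  have hmem : ∀ h b, mem (h ++ [b]) = upd (mem h) b := fun h b => by simp [mem]
  have hstate : ∀ h, G.stateAfter (induced s h) = S.state (mem h) := by
    intro h
    induction h using List.reverseRecOn with
    | nil => exact hm₀.symm
    | append_singleton h b ih =>
      rw [stateAfter_induced_snoc, ih, hmem]
      exact (S.state_upd (mem h) (G.move _ _ b)).symm
  refine ⟨s, fun β => ?_, fun h => ?_⟩
  · let m : ℕ → S.M := fun n => mem (List.ofFn fun i : Fin n => β i)
    have htrace : G.trace s β = fun n => (G.move (S.state (m n)) (a (m n)) (β n)).1 := by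
      funext n
      simp only [trace, hstate]
      rfl
    rw [htrace]
    refine hwin m (fun n => G.move (S.state (m n)) (a (m n)) (β n)) rfl fun n => ⟨?_, ?_⟩
    · simp only [Controller.opts, ← ha]
      exact mem_moves.mpr ⟨_, rfl⟩
    · simp only [m, ofFn_prefix_succ, hmem]
      rfl
  · refine ⟨S.M, hfin h, m₀, fun _ m => a m, fun _ m b => upd m b, mem, rfl, fun h b => hmem h b,
      fun h => rfl⟩

end Game

namespace OnePlayerGame

variable {A Q C : Type*} {fm : Prop} {W : Set (ℕ → C)}

theorem stateAt_succ (G : OnePlayerGame A Q C) (s : ℕ → A) (n : ℕ) :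
    G.stateAt s (n + 1) = G.next (G.stateAt s n) (s n) := by
  simp only [stateAt, stateAfter, Game.ofFn_prefix_succ, List.foldl_append, List.foldl_cons,
    List.foldl_nil]

end OnePlayerGame

/-- The positional response turns the strategy into one sequence of actions, whose trace is that of
the strategy against one run `b` of Player 2. -/
theorem Game.winsWith_against {A₁ A₂ Q C : Type*} {fm : Prop} {W : Set (ℕ → C)}
    {G : Game A₁ A₂ Q C} (h : G.WinsWith fm W) (β : Q → A₁ → A₂) :
    (G.against β).WinsWith fm W := by
  obtain ⟨s, hs, hfm⟩ := h
  let hist : ℕ → List A₂ := fun n =>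
    Nat.rec [] (fun _ h => h ++ [β (G.stateAfter (induced s h)) (s h)]) n
  have hsucc : ∀ n, hist (n + 1) = hist n ++ [β (G.stateAfter (induced s (hist n))) (s (hist n))] :=
    fun n => rfl
  let b : ℕ → A₂ := fun n => β (G.stateAfter (induced s (hist n))) (s (hist n))
  have hb : ∀ n, (List.ofFn fun i : Fin n => b i) = hist n := by
    intro n
    induction n with
    | zero => rfl
    | succ n ih => rw [ofFn_prefix_succ, ih, hsucc]
  have hstate : ∀ n, (G.against β).stateAt (fun n => s (hist n)) n =
      G.stateAfter (induced s (hist n)) := by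
    intro n
    induction n with
    | zero => rfl
    | succ n ih => rw [OnePlayerGame.stateAt_succ, ih, hsucc, stateAfter_induced_snoc]; rfl
  refine ⟨fun n => s (hist n), ?_, fun h => ?_⟩
  · have : (G.against β).trace (fun n => s (hist n)) = G.trace s b := by
      funext n
      simp only [OnePlayerGame.trace, hstate, trace, hb]
      rfl
    unfold OnePlayerGame.IsWinning
    rw [this]
    exact hs b
  · obtain ⟨M, hM, m₀, σ, μ, m, h0, h1, h2⟩ := hfm h
    refine ⟨M, hM, m₀, σ, fun q x => μ q x (β q (σ q x)), fun n => m (hist n), h0, fun n => ?_,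
      fun n => ?_⟩
    · simp only [hstate, hsucc, h1, h2 (hist n)]
    · simp only [hstate]; exact h2 _

/-- If Player 1 beats a response to her labels in the one-player game, then she has a winning
controller against this response. -/
theorem OnePlayerGame.winnable_of_winsWith {A C L : Type*} {Q : Type} [Finite Q] {fm : Prop}
    {W : Set (ℕ → C)} (G : OnePlayerGame A Q C) (lab : Q → A → L) (τ : Q → L → C × Q)
    (hτ : ∀ q a, τ q (lab q a) = (G.col q a, G.next q a)) (h : G.WinsWith fm W) :
    Winnable fm (fun q => Set.range (lab q)) W (fun q l => {τ q l}) G.init := by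
  obtain ⟨s, hs, hfm⟩ := h
  by_cases h : fm
  · obtain ⟨M, hM, m₀, σ, μ, m, h0, h1, h2⟩ := hfm h
    let S : Controller Q C L :=
      { M := Q × M
        state := Prod.fst
        act := fun z => lab z.1 (σ z.1 z.2)
        upd := fun z e => (e.2, μ z.1 z.2)
        state_upd := fun _ _ => rfl }
    refine ⟨S, fun _ => inferInstanceAs (Finite (Q × M)), fun z => ⟨_, rfl⟩, (G.init, m₀), rfl,
      fun x e hx hplay => ?_⟩
    have he : ∀ n, e n = (G.col (x n).1 (σ (x n).1 (x n).2), G.next (x n).1 (σ (x n).1 (x n).2)) :=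
      fun n => (Finset.mem_singleton.mp (hplay n).1).trans (hτ _ _)
    have hxn : ∀ n, x n = (G.stateAt s n, m n) := by
      intro n
      induction n with
      | zero => rw [hx, ← h0]; rfl
      | succ n ih =>
        rw [(hplay n).2]
        change ((e n).2, μ (x n).1 (x n).2) = _
        rw [he, ih, stateAt_succ, h1, h2 n]
    have : (fun n => (e n).1) = G.trace s := by
      funext n
      rw [he, hxn, trace, h2 n]
    rw [this]
    exact hs
  -- Without memory restriction a round counter suffices, since a one-player strategy depends only
  -- on time.
  · let S : Controller Q C L :=
      { M := Q × ℕ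
        state := Prod.fst
        act := fun z => lab z.1 (s z.2)
        upd := fun z e => (e.2, z.2 + 1)
        state_upd := fun _ _ => rfl }
    refine ⟨S, fun h' => absurd h' h, fun z => ⟨_, rfl⟩, (G.init, 0), rfl,
      fun x e hx hplay => ?_⟩
    have he : ∀ n, e n = (G.col (x n).1 (s (x n).2), G.next (x n).1 (s (x n).2)) :=
      fun n => (Finset.mem_singleton.mp (hplay n).1).trans (hτ _ _)
    have hxn : ∀ n, x n = (G.stateAt s n, n) := by
      intro n
      induction n with
      | zero => rw [hx]; rfl
      | succ n ih =>
        rw [(hplay n).2]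
        change ((e n).2, (x n).2 + 1) = _
        rw [he, ih, stateAt_succ]
    have : (fun n => (e n).1) = G.trace s := by
      funext n
      rw [he, hxn, trace]
    rw [this]
    exact hs

/-! ### Reduction to a rich family of positional responses -/

namespace Game

variable {A₁ A₂ C : Type*} {Q : Type} [Finite Q] [Finite C] [Fintype A₂] [Nonempty A₂]
  {fm : Prop} {W : Set (ℕ → C)}

/-- A family of positional responses of Player 2 is rich if it realizes every choice of moves
that only depends on the state and on the set of possible moves. -/
def IsRich (G : Game A₁ A₂ Q C) {ι : Type*} (β : ι → Q → A₁ → A₂) : Prop :=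
  ∀ τ : Q → {S : Finset (C × Q) // S.Nonempty} → C × Q, (∀ q l, τ q l ∈ l.1) →
    ∃ i, ∀ q a, G.move q a (β i q a) = τ q (G.moves q a)

/-- With sets of moves as labels, a choice of one option per state and label is a choice of moves,
and richness provides a response in the family that realizes it. -/
theorem winsWith_iff_of_isRich (hW : ClosedUnderInterleaving W) (hW' : ClosedUnderPrefixRemoval W)
    (G : Game A₁ A₂ Q C) {ι : Type*} {β : ι → Q → A₁ → A₂} (hβ : G.IsRich β) :
    (∀ i, (G.against (β i)).WinsWith fm W) ↔ G.WinsWith fm W := by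
  refine ⟨fun h => G.winsWith_of_winnable ?_, fun h i => winsWith_against h _⟩
  refine Winnable.of_forall_choice_of_prefixRemoval hW hW' (fun _ l => l.2) fun τ hτ => ?_
  obtain ⟨i, hi⟩ := hβ τ hτ
  exact OnePlayerGame.winnable_of_winsWith _ _ τ (fun q a => (hi q a).symm) (h i)

theorem forall_winsWith_iff_of_isRich (hW : ClosedUnderInterleaving W)
    (G : Game A₁ A₂ Q C) {ι : Type*} {β : ι → Q → A₁ → A₂} (hβ : G.IsRich β) :
    (∀ q i, ((G.startAt q).against (β i)).WinsWith fm W) ↔ ∀ q, (G.startAt q).WinsWith fm W := by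
  refine ⟨fun h q => (G.startAt q).winsWith_of_winnable ?_, fun h q i => winsWith_against (h q) _⟩
  refine Winnable.of_forall_choice hW (fun _ l => l.2) (fun τ hτ p => ?_) q
  obtain ⟨i, hi⟩ := hβ τ hτ
  exact OnePlayerGame.winnable_of_winsWith _ _ τ (fun q a => (hi q a).symm) (h p i)

end Game

/-! ## Terms and blocks with lists of arguments -/

namespace Term

def cell (x : ℕ) (l : List Term) : Term := .read x l.length l.get

def entry (i : InputSym) (l : List Term) : Term := .input i l.length l.get

def add (s t : Term) : Term := .arith .add s t
def sub (s t : Term) : Term := .arith .sub s t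
def mul (s t : Term) : Term := .arith .mul s t
def div (s t : Term) : Term := .arith .div s t
def mod (s t : Term) : Term := s.sub (t.mul (s.div t))

variable {𝒞 : Type*} {B : Primitives 𝒞} {I : Input 𝒞} {m : Memory 𝒞} {s t : Term} {x y : ℕ}

theorem ofFn_eval_get (l : List Term) :
    (List.ofFn fun j => (l.get j).eval B I m) = l.map (Term.eval B I m) := by
  conv_rhs => rw [← List.ofFn_get l, List.map_ofFn]
  rfl

@[simp] theorem eval_const (n : ℕ) : (const n).eval B I m = .inl n := rfl

@[simp] theorem eval_cell (x : ℕ) (l : List Term) :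
    (cell x l).eval B I m = m x (l.map (Term.eval B I m)) :=
  congrArg (m x) (ofFn_eval_get l)

@[simp] theorem eval_entry (i : InputSym) (l : List Term) :
    (entry i l).eval B I m = I i (l.map (Term.eval B I m)) :=
  congrArg (I i) (ofFn_eval_get l)

theorem eval_add (hs : s.eval B I m = .inl x) (ht : t.eval B I m = .inl y) :
    (s.add t).eval B I m = .inl (x + y) := by
  simp [add, Term.eval, hs, ht, ArithOp.eval]

theorem eval_sub (hs : s.eval B I m = .inl x) (ht : t.eval B I m = .inl y) :
    (s.sub t).eval B I m = .inl (x - y) := by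
  simp [sub, Term.eval, hs, ht, ArithOp.eval]

theorem eval_mul (hs : s.eval B I m = .inl x) (ht : t.eval B I m = .inl y) :
    (s.mul t).eval B I m = .inl (x * y) := by
  simp [mul, Term.eval, hs, ht, ArithOp.eval]

theorem eval_div (hs : s.eval B I m = .inl x) (ht : t.eval B I m = .inl y) :
    (s.div t).eval B I m = .inl (x / y) := by
  simp [div, Term.eval, hs, ht, ArithOp.eval]

theorem eval_mod (hs : s.eval B I m = .inl x) (ht : t.eval B I m = .inl y) :
    (s.mod t).eval B I m = .inl (x % y) := by
  rw [Nat.mod_eq_sub]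
  exact eval_sub hs (eval_mul ht (eval_div hs ht))

end Term

namespace Block

def set (x : ℕ) (l : List Term) (t : Term) : Block := .write x l.length l.get t

variable {𝒞 : Type*} {B : Primitives 𝒞} {I : Input 𝒞} {m : Memory 𝒞}

open Classical in
theorem exec_set (x : ℕ) (l : List Term) (t : Term) :
    (set x l t).exec B I m = fun y l' =>
      if y = x ∧ l' = l.map (Term.eval B I m) then t.eval B I m else m y l' := by
  rw [← Term.ofFn_eval_get]
  rfl

theorem exec_seq (c d : Block) : (seq c d).exec B I m = d.exec B I (c.exec B I m) := rfl

theorem exec_ifEq {s t : Term} {x y : ℕ} (hs : s.eval B I m = .inl x) (ht : t.eval B I m = .inl y)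
    (c d : Block) :
    (ifEq s t c d).exec B I m = if x = y then c.exec B I m else d.exec B I m := by
  classical
  simp only [exec, hs, ht]
  by_cases h : x = y <;> simp [h]

end Block

/-! ## The memory of the deciding program -/

/-- The content of the memory: the output cell, the number of the current run, a step counter, the
next free weight and the weights of moves, the actions that realize a move, the sum of the weights
of the moves of an action, the place values of sets of moves and the next free one, and the
arrays of the simulated program. Next free values are stored decreased by one. -/
structure Tables (𝒞 : Type*) where
  out : ℕ
  run : ℕ
  time : ℕ
  pow : ℕ
  weight : ℕ → ℕ
  sel : ℕ × ℕ × ℕ → ℕ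
  mask : ℕ × ℕ → ℕ
  place : ℕ × ℕ → ℕ
  total : ℕ
  arr : Memory 𝒞

namespace Tables

variable {𝒞 : Type*}

def toMemory (S : Tables 𝒞) : Memory 𝒞
  | 0, [] => .inl S.out
  | 1, [] => .inl S.run
  | 2, [] => .inl S.time
  | 3, [] => .inl S.pow
  | 4, [.inl p] => .inl (S.weight p)
  | 5, [.inl q, .inl a, .inl p] => .inl (S.sel (q, a, p))
  | 6, [.inl q, .inl a] => .inl (S.mask (q, a))
  | 7, [.inl q, .inl x] => .inl (S.place (q, x))
  | 8, [] => .inl S.total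
  | x + 9, l => S.arr x l
  | _, _ => .inl 0

def zero (𝒞 : Type*) : Tables 𝒞 where
  out := 0
  run := 0
  time := 0
  pow := 0
  weight _ := 0
  sel _ := 0
  mask _ := 0
  place _ := 0
  total := 0
  arr _ _ := .inl 0

theorem toMemory_zero : (zero 𝒞).toMemory = fun _ _ => .inl 0 := by
  funext y l
  unfold toMemory
  split <;> rfl

variable (S : Tables 𝒞)

@[simp] theorem toMemory_add_nine (x : ℕ) (l : List (Value 𝒞)) :
    S.toMemory (x + 9) l = S.arr x l := by
  simp [toMemory]

theorem toMemory_of_lt {S : Tables 𝒞} {y : ℕ} (hy : y < 9) (l : List (Value 𝒞))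
    (m m' : Memory 𝒞) :
    { S with arr := m }.toMemory y l = { S with arr := m' }.toMemory y l := by
  unfold toMemory
  split <;> first | rfl | omega

theorem toMemory_set_aux {S S' : Tables 𝒞} {x : ℕ} {l : List (Value 𝒞)} {v : Value 𝒞}
    {_ : ∀ y l', Decidable (y = x ∧ l' = l)}
    (h : S'.toMemory x l = v) (h' : ∀ y l', ¬ (y = x ∧ l' = l) → S'.toMemory y l' = S.toMemory y l') :
    (fun y l' => if y = x ∧ l' = l then v else S.toMemory y l') = S'.toMemory := by
  funext y l'
  split_ifs with hc
  · rw [hc.1, hc.2, h]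
  · rw [h' y l' hc]

section Set

variable {B : Primitives 𝒞} {I : Input 𝒞} {s t u w : Term} {v x y z : ℕ}

theorem set_out (ht : t.eval B I S.toMemory = .inl v) :
    (Block.set 0 [] t).exec B I S.toMemory = { S with out := v }.toMemory := by
  rw [Block.exec_set]
  refine toMemory_set_aux (by rw [ht]; rfl) fun y l h => ?_
  unfold toMemory
  split <;> simp_all

theorem set_run (ht : t.eval B I S.toMemory = .inl v) :
    (Block.set 1 [] t).exec B I S.toMemory = { S with run := v }.toMemory := by
  rw [Block.exec_set]
  refine toMemory_set_aux (by rw [ht]; rfl) fun y l h => ?_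
  unfold toMemory
  split <;> simp_all

theorem set_time (ht : t.eval B I S.toMemory = .inl v) :
    (Block.set 2 [] t).exec B I S.toMemory = { S with time := v }.toMemory := by
  rw [Block.exec_set]
  refine toMemory_set_aux (by rw [ht]; rfl) fun y l h => ?_
  unfold toMemory
  split <;> simp_all

theorem set_pow (ht : t.eval B I S.toMemory = .inl v) :
    (Block.set 3 [] t).exec B I S.toMemory = { S with pow := v }.toMemory := by
  rw [Block.exec_set]
  refine toMemory_set_aux (by rw [ht]; rfl) fun y l h => ?_
  unfold toMemory
  split <;> simp_all

theorem set_weight (hs : s.eval B I S.toMemory = .inl x) (ht : t.eval B I S.toMemory = .inl v) :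
    (Block.set 4 [s] t).exec B I S.toMemory =
      { S with weight := Function.update S.weight x v }.toMemory := by
  rw [Block.exec_set]
  refine toMemory_set_aux (by simp [ht, hs, toMemory]) fun y l h => ?_
  unfold toMemory
  split <;> simp_all

theorem set_sel (hs : s.eval B I S.toMemory = .inl x) (hu : u.eval B I S.toMemory = .inl y)
    (hw : w.eval B I S.toMemory = .inl z) (ht : t.eval B I S.toMemory = .inl v) :
    (Block.set 5 [s, u, w] t).exec B I S.toMemory =
      { S with sel := Function.update S.sel (x, y, z) v }.toMemory := by
  rw [Block.exec_set]
  refine toMemory_set_aux (by simp [ht, hs, hu, hw, toMemory]) fun y l h => ?_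
  unfold toMemory
  split <;> simp_all

theorem set_mask (hs : s.eval B I S.toMemory = .inl x) (hu : u.eval B I S.toMemory = .inl y)
    (ht : t.eval B I S.toMemory = .inl v) :
    (Block.set 6 [s, u] t).exec B I S.toMemory =
      { S with mask := Function.update S.mask (x, y) v }.toMemory := by
  rw [Block.exec_set]
  refine toMemory_set_aux (by simp [ht, hs, hu, toMemory]) fun y l h => ?_
  unfold toMemory
  split <;> simp_all

theorem set_place (hs : s.eval B I S.toMemory = .inl x) (hu : u.eval B I S.toMemory = .inl y)
    (ht : t.eval B I S.toMemory = .inl v) :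
    (Block.set 7 [s, u] t).exec B I S.toMemory =
      { S with place := Function.update S.place (x, y) v }.toMemory := by
  rw [Block.exec_set]
  refine toMemory_set_aux (by simp [ht, hs, hu, toMemory]) fun y l h => ?_
  unfold toMemory
  split <;> simp_all

theorem set_total (ht : t.eval B I S.toMemory = .inl v) :
    (Block.set 8 [] t).exec B I S.toMemory = { S with total := v }.toMemory := by
  rw [Block.exec_set]
  refine toMemory_set_aux (by rw [ht]; rfl) fun y l h => ?_
  unfold toMemory
  split <;> simp_all

end Set

end Tables

/-! ## Simulation of a one-player program -/

namespace Decider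

def run : Term := .cell 1 []
def time : Term := .cell 2 []
def total : Term := (Term.cell 8 []).add (.const 1)
def numA₁ : Term := .entry .numA₁ []
def numA₂ : Term := .entry .numA₂ []
def numQ : Term := .entry .numQ []
def numC : Term := .entry .numC []

/-- The move that Player 2 has fixed for the action `y` in the state `x` in the current run. -/
def digit (x y : Term) : Term :=
  ((run.mod total).div (.cell 7 [x, .cell 6 [x, y]])).mod (numC.mul numQ)

/-- The action by which Player 2 responds to the action `y` in the state `x`. -/
def response (x y : Term) : Term := (Term.cell 5 [x, y, digit x y]).sub (.const 1)

/-- The input of the one-player game of the current run. -/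
def simInput (start : Term) : InputSym → List Term → Term
  | .numA₂, [] => .const 1
  | .numA₂, _ => .const 0
  | .start, [] => start
  | .start, _ => .const 0
  | .next, [x, y] => .entry .next [x, y, response x y]
  | .next, _ => .const 0
  | .col, [x, y] => .entry .col [x, y, response x y]
  | .col, _ => .const 0
  | i, l => .entry i l

/-- The run number is an extra first index of every simulated array. Each run therefore finds cells
that hold 0, and no steps are spent on clearing memory. The shift by 9 avoids the cells of the
tables. -/
def simTerm (start : Term) : Term → Term
  | .const n => .const n
  | .arith o s t => .arith o (simTerm start s) (simTerm start t)
  | .prim p k args => .prim p k fun j => simTerm start (args j)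
  | .input i _ args => simInput start i (List.ofFn fun j => simTerm start (args j))
  | .read x k args => .read (x + 9) (k + 1) (Fin.cons run fun j => simTerm start (args j))

def simBlock (start : Term) : Block → Block
  | .skip => .skip
  | .write x k args t =>
    .write (x + 9) (k + 1) (Fin.cons run fun j => simTerm start (args j)) (simTerm start t)
  | .seq c d => .seq (simBlock start c) (simBlock start d)
  | .ifEq s t c d =>
    .ifEq (simTerm start s) (simTerm start t) (simBlock start c) (simBlock start d)

variable {𝒞 : Type*} {B : Primitives 𝒞} {I I' : Input 𝒞} {start : Term}

open Classical in
/-- The arrays `m`, where the memory of the run `r` is replaced by `m'`. -/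
noncomputable def overlay (r : ℕ) (m m' : Memory 𝒞) : Memory 𝒞
  | y, [] => m y []
  | y, v :: l => if v = .inl r then m' y l else m y (v :: l)

/-- With the tables `S`, the terms for the input of the simulated program evaluate to `I'`. -/
def Simulates (B : Primitives 𝒞) (I : Input 𝒞) (start : Term) (S : Tables 𝒞) (I' : Input 𝒞) :
    Prop :=
  ∀ arr i l, (simInput start i l).eval B I { S with arr := arr }.toMemory =
    I' i (l.map (Term.eval B I { S with arr := arr }.toMemory))

theorem eval_simTerm {S : Tables 𝒞} (hS : Simulates B I start S I') (m m' : Memory 𝒞) (t : Term) :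
    (simTerm start t).eval B I { S with arr := overlay S.run m m' }.toMemory =
      t.eval B I' m' := by
  induction t with
  | const n => rfl
  | arith o s t hs ht => simp only [simTerm, Term.eval, hs, ht]
  | prim p k args ih => simp only [simTerm, Term.eval, ih]
  | input i k args ih =>
    rw [simTerm, hS, List.map_ofFn]
    simp only [Function.comp_def, ih, Term.eval]
  | read x k args ih =>
    simp only [simTerm, Term.eval, List.ofFn_succ, Fin.cons_zero, Fin.cons_succ, ih]
    simp [run, Tables.toMemory, overlay]

/-- A simulated write has the current run as its first index, so it changes neither the tables nor
the arrays of other runs. -/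
theorem exec_simBlock {S : Tables 𝒞} (hS : Simulates B I start S I') (P : Block)
    (m m' : Memory 𝒞) :
    (simBlock start P).exec B I { S with arr := overlay S.run m m' }.toMemory =
      { S with arr := overlay S.run m (P.exec B I' m') }.toMemory := by
  classical
  induction P generalizing m' with
  | skip => rfl
  | write x k args t =>
    have hrun : run.eval B I { S with arr := overlay S.run m m' }.toMemory = .inl S.run := by
      simp [run, Tables.toMemory]
    simp only [simBlock, Block.exec, List.ofFn_succ, Fin.cons_zero, Fin.cons_succ,
      eval_simTerm hS, hrun]
    refine Tables.toMemory_set_aux (by simp [Tables.toMemory, overlay]) fun y l h => ?_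
    rcases lt_or_ge y 9 with hy | hy
    · exact Tables.toMemory_of_lt hy l _ _
    obtain ⟨z, rfl⟩ := Nat.exists_eq_add_of_le' hy
    simp only [Tables.toMemory_add_nine]
    cases l with
    | nil => rfl
    | cons v l =>
      simp only [overlay]
      split_ifs with hv hc
      · exact absurd ⟨by rw [hc.1], by rw [hv, hc.2]⟩ h
      · rfl
      · rfl
  | seq c d hc hd => simp only [simBlock, Block.exec, hc, hd]
  | ifEq s t c d hc hd =>
    simp only [simBlock, Block.exec, eval_simTerm hS, hc, hd]
    split_ifs <;> rfl

end Decider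

/-! ## Numbering objects in the order of their discovery -/

/-- `T` maps the elements of `D` to distinct powers of `b`, the smallest unused one being `u`. -/
def IsNumbering {κ : Type*} (b : ℕ) (T : κ → ℕ) (u : ℕ) (D : Finset κ) : Prop :=
  ∃ i : κ → ℕ, Set.InjOn i D ∧ (∀ x ∈ D, i x < D.card ∧ T x = b ^ i x) ∧ (∀ x ∉ D, T x = 0) ∧
    u = b ^ D.card

namespace IsNumbering

variable {κ : Type*} {b : ℕ} {T : κ → ℕ} {u : ℕ} {D : Finset κ}

theorem empty (b : ℕ) : IsNumbering b (fun _ : κ => 0) 1 ∅ :=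
  ⟨fun _ => 0, by simp, by simp, by simp, by simp⟩

theorem mem_iff (h : IsNumbering b T u D) (hb : 0 < b) (x : κ) : x ∈ D ↔ T x ≠ 0 := by
  obtain ⟨i, -, h₁, h₂, -⟩ := h
  refine ⟨fun hx => ?_, fun hx => by_contra fun hx' => hx (h₂ x hx')⟩
  rw [(h₁ x hx).2]
  positivity

theorem insert [DecidableEq κ] (h : IsNumbering b T u D) {x : κ} (hx : x ∉ D) :
    IsNumbering b (Function.update T x u) (b * u) (insert x D) := by
  obtain ⟨i, hi, h₁, h₂, rfl⟩ := h
  have hne : ∀ y ∈ D, y ≠ x := fun y hy h => hx (h ▸ hy)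
  have hup : ∀ y ∈ D, Function.update i x D.card y = i y := fun y hy =>
    Function.update_of_ne (hne y hy) _ _
  refine ⟨Function.update i x D.card, ?_, fun y hy => ?_, fun y hy => ?_, ?_⟩
  · rw [Finset.coe_insert, Set.injOn_insert (by simpa using hx)]
    refine ⟨fun y hy z hz h => hi hy hz (by rwa [hup y hy, hup z hz] at h), ?_⟩
    rintro ⟨y, hy, h⟩
    rw [hup y hy, Function.update_self] at h
    exact (h₁ y hy).1.ne h
  · rw [Finset.card_insert_of_notMem hx]
    rcases Finset.mem_insert.mp hy with rfl | hy
    · simp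
    · rw [hup y hy, Function.update_of_ne (hne y hy)]
      exact ⟨(h₁ y hy).1.trans (Nat.lt_succ_self _), (h₁ y hy).2⟩
  · rw [Finset.mem_insert, not_or] at hy
    rw [Function.update_of_ne hy.1, h₂ y hy.2]
  · rw [Finset.card_insert_of_notMem hx, pow_succ, mul_comm]

theorem sum_eq (h : IsNumbering 2 T u D) :
    ∃ i : κ → ℕ, Set.InjOn i D ∧ (∀ x ∈ D, i x < D.card) ∧
      ∀ s ⊆ D, ∑ x ∈ s, T x = ∑ j ∈ s.image i, 2 ^ j := by
  obtain ⟨i, hi, h₁, -, -⟩ := h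
  refine ⟨i, hi, fun x hx => (h₁ x hx).1, fun s hs => ?_⟩
  rw [Finset.sum_image (hi.mono hs)]
  exact Finset.sum_congr rfl fun x hx => (h₁ x (hs hx)).2

theorem sum_lt (h : IsNumbering 2 T u D) {s : Finset κ} (hs : s ⊆ D) :
    ∑ x ∈ s, T x < 2 ^ D.card := by
  obtain ⟨i, -, h₁, h₂⟩ := h.sum_eq
  rw [h₂ s hs]
  refine Nat.geomSum_lt le_rfl fun j hj => ?_
  obtain ⟨x, hx, rfl⟩ := Finset.mem_image.mp hj
  exact h₁ x (hs hx)

/-- The weights are distinct powers of two, so the sum is a binary expansion from which the set can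
be read off. -/
theorem sum_injOn (h : IsNumbering 2 T u D) {s s' : Finset κ} (hs : s ⊆ D) (hs' : s' ⊆ D)
    (heq : ∑ x ∈ s, T x = ∑ x ∈ s', T x) : s = s' := by
  obtain ⟨i, hi, -, h₂⟩ := h.sum_eq
  rw [h₂ s hs, h₂ s' hs'] at heq
  have := Finset.geomSum_injective le_rfl heq
  apply Finset.coe_injective
  rw [← hi.image_eq_image_iff (by exact_mod_cast hs) (by exact_mod_cast hs')]
  rw [← Finset.coe_image, ← Finset.coe_image, this]

end IsNumbering

/-! ## Preprocessing -/

namespace Decider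

def state : Term := (time.div numA₂).div numA₁
def action₁ : Term := (time.div numA₂).mod numA₁
def action₂ : Term := time.mod numA₂
def moveCode : Term :=
  (Term.entry .next [state, action₁, action₂]).add
    (numQ.mul (.entry .col [state, action₁, action₂]))
def moveSet : Term := .cell 6 [state, action₁]

/-- Give a weight to the current move, unless it has one. -/
def weigh : Block :=
  .ifEq (.cell 4 [moveCode]) (.const 0)
    (.seq (.set 4 [moveCode] ((Term.cell 3 []).add (.const 1)))
      (.set 3 [] (((Term.const 2).mul (.cell 3 [])).add (.const 1)))) .skip

/-- Add the current move to the set of moves of the current state and action. -/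
def collect : Block :=
  .ifEq (.cell 5 [state, action₁, moveCode]) (.const 0)
    (.seq (.set 5 [state, action₁, moveCode] (action₂.add (.const 1)))
      (.set 6 [state, action₁] (moveSet.add (.cell 4 [moveCode])))) .skip

/-- Give a place value to the current set of moves when it is complete, unless it has one. -/
def register : Block :=
  .ifEq (action₂.add (.const 1)) numA₂
    (.ifEq (.cell 7 [state, moveSet]) (.const 0)
      (.seq (.set 7 [state, moveSet] total)
        (.set 8 [] (((numC.mul numQ).mul total).sub (.const 1)))) .skip) .skip

def preprocess : Block :=
  .seq (.seq (.seq weigh collect) register) (.set 2 [] (time.add (.const 1)))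

end Decider

/-! ### Preprocessing as an operation on tables -/

namespace Tables

variable {𝒞 : Type*}

def weigh (S : Tables 𝒞) (p : ℕ) : Tables 𝒞 :=
  if S.weight p = 0 then
    { S with weight := Function.update S.weight p (S.pow + 1), pow := 2 * S.pow + 1 }
  else S

def collect (S : Tables 𝒞) (q a b p : ℕ) : Tables 𝒞 :=
  if S.sel (q, a, p) = 0 then
    { S with
      sel := Function.update S.sel (q, a, p) (b + 1)
      mask := Function.update S.mask (q, a) (S.mask (q, a) + S.weight p) }
  else S

def register (S : Tables 𝒞) (q a N : ℕ) : Tables 𝒞 :=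
  if S.place (q, S.mask (q, a)) = 0 then
    { S with
      place := Function.update S.place (q, S.mask (q, a)) (S.total + 1)
      total := N * (S.total + 1) - 1 }
  else S

def tick (S : Tables 𝒞) : Tables 𝒞 := { S with time := S.time + 1 }

theorem time_weigh (S : Tables 𝒞) (p : ℕ) : (S.weigh p).time = S.time := by
  unfold Tables.weigh
  split_ifs <;> rfl

theorem time_collect (S : Tables 𝒞) (q a b p : ℕ) : (S.collect q a b p).time = S.time := by
  unfold Tables.collect
  split_ifs <;> rfl

theorem time_register (S : Tables 𝒞) (q a N : ℕ) : (S.register q a N).time = S.time := by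
  unfold Tables.register
  split_ifs <;> rfl

end Tables

section Preprocessing

variable {𝒞 : Type*} {B : Primitives 𝒞} {a₁ a₂ n k : ℕ} {c : Fin k ↪ 𝒞}
  {G : Game (Fin a₁) (Fin a₂) (Fin n) (Fin k)}

/-- Triples are numbered with the action of Player 2 varying fastest. A set of moves is thus
complete exactly after the last action of Player 2. -/
def triple (q : Fin n) (a : Fin a₁) (b : Fin a₂) : Fin (n * a₁ * a₂) :=
  finProdFinEquiv (finProdFinEquiv (q, a), b)

theorem triple_val (q : Fin n) (a : Fin a₁) (b : Fin a₂) :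
    (triple q a b : ℕ) = b + a₂ * (a + a₁ * q) := rfl

theorem triple_surjective (t : Fin (n * a₁ * a₂)) : ∃ q a b, triple q a b = t := by
  obtain ⟨⟨x, b⟩, rfl⟩ := finProdFinEquiv.surjective t
  obtain ⟨⟨q, a⟩, rfl⟩ := finProdFinEquiv.surjective x
  exact ⟨q, a, b, rfl⟩

theorem triple_inj {q q' : Fin n} {a a' : Fin a₁} {b b' : Fin a₂} :
    triple q a b = triple q' a' b' ↔ q = q' ∧ a = a' ∧ b = b' := by
  simp [triple, and_assoc]

def Game.code (G : Game (Fin a₁) (Fin a₂) (Fin n) (Fin k)) (q : Fin n) (a : Fin a₁) (b : Fin a₂) :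
    ℕ :=
  finProdFinEquiv (G.move q a b)

theorem Game.code_lt (G : Game (Fin a₁) (Fin a₂) (Fin n) (Fin k)) (q : Fin n) (a : Fin a₁)
    (b : Fin a₂) : G.code q a b < k * n :=
  (finProdFinEquiv (G.move q a b)).2

theorem toFin?_val (q : Fin n) : toFin? (𝒞 := 𝒞) n (.inl q) = some q := by simp [toFin?]

/-! ### Correctness of the preprocessing block -/

namespace Decider

variable {S : Tables 𝒞}

theorem eval_run : run.eval B (G.toInput c) S.toMemory = .inl S.run := by
  simp [run, Tables.toMemory]

theorem eval_time : time.eval B (G.toInput c) S.toMemory = .inl S.time := by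
  simp [time, Tables.toMemory]

theorem eval_total : total.eval B (G.toInput c) S.toMemory = .inl (S.total + 1) :=
  Term.eval_add (by simp [Tables.toMemory]) rfl

theorem eval_numA₁ {m : Memory 𝒞} : numA₁.eval B (G.toInput c) m = .inl a₁ := rfl
theorem eval_numA₂ {m : Memory 𝒞} : numA₂.eval B (G.toInput c) m = .inl a₂ := rfl
theorem eval_numQ {m : Memory 𝒞} : numQ.eval B (G.toInput c) m = .inl n := rfl
theorem eval_numC {m : Memory 𝒞} : numC.eval B (G.toInput c) m = .inl k := rfl

variable {q : Fin n} {a : Fin a₁} {b : Fin a₂}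

theorem eval_state (ht : S.time = triple q a b) :
    state.eval B (G.toInput c) S.toMemory = .inl q := by
  have h := Term.eval_div (Term.eval_div (eval_time (B := B) (G := G) (c := c) (S := S)) eval_numA₂)
    eval_numA₁
  rw [state, h, ht, triple_val, Nat.add_mul_div_left _ _ b.pos, Nat.div_eq_of_lt b.2, Nat.zero_add,
    Nat.add_mul_div_left _ _ a.pos, Nat.div_eq_of_lt a.2, Nat.zero_add]

theorem eval_action₁ (ht : S.time = triple q a b) :
    action₁.eval B (G.toInput c) S.toMemory = .inl a := by
  have h := Term.eval_mod (Term.eval_div (eval_time (B := B) (G := G) (c := c) (S := S)) eval_numA₂)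
    eval_numA₁
  rw [action₁, h, ht, triple_val, Nat.add_mul_div_left _ _ b.pos, Nat.div_eq_of_lt b.2,
    Nat.zero_add, Nat.add_mul_mod_self_left, Nat.mod_eq_of_lt a.2]

theorem eval_action₂ (ht : S.time = triple q a b) :
    action₂.eval B (G.toInput c) S.toMemory = .inl b := by
  have h := Term.eval_mod (eval_time (B := B) (G := G) (c := c) (S := S)) eval_numA₂
  rw [action₂, h, ht, triple_val, Nat.add_mul_mod_self_left, Nat.mod_eq_of_lt b.2]

theorem eval_moveCode (ht : S.time = triple q a b) :
    moveCode.eval B (G.toInput c) S.toMemory = .inl (G.code q a b) := by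
  refine Term.eval_add (x := G.next q a b) ?_ (Term.eval_mul eval_numQ (y := G.col q a b) ?_) <;>
    simp [eval_state ht, eval_action₁ ht, eval_action₂ ht, Game.toInput, toFin?_val]

theorem eval_moveSet (ht : S.time = triple q a b) :
    moveSet.eval B (G.toInput c) S.toMemory = .inl (S.mask (q, a)) := by
  simp [moveSet, eval_state ht, eval_action₁ ht, Tables.toMemory]

theorem exec_weigh (ht : S.time = triple q a b) :
    weigh.exec B (G.toInput c) S.toMemory = (S.weigh (G.code q a b)).toMemory := by
  rw [weigh, Block.exec_ifEq (x := S.weight (G.code q a b)) (y := 0)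
    (by simp [eval_moveCode ht, Tables.toMemory]) rfl, Tables.weigh]
  split_ifs
  · rw [Block.exec_seq, Tables.set_weight S (eval_moveCode ht)
      (Term.eval_add (x := S.pow) (by simp [Tables.toMemory]) rfl),
      Tables.set_pow _ (Term.eval_add (Term.eval_mul rfl (y := S.pow)
        (by simp [Tables.toMemory])) rfl)]
  · rfl

theorem exec_collect (ht : S.time = triple q a b) :
    collect.exec B (G.toInput c) S.toMemory = (S.collect q a b (G.code q a b)).toMemory := by
  rw [collect, Block.exec_ifEq (x := S.sel (q, a, G.code q a b)) (y := 0)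
    (by simp [eval_moveCode ht, eval_state ht, eval_action₁ ht, Tables.toMemory]) rfl,
    Tables.collect]
  split_ifs
  · rw [Block.exec_seq, Tables.set_sel S (eval_state ht) (eval_action₁ ht) (eval_moveCode ht)
      (Term.eval_add (eval_action₂ ht) rfl)]
    refine Tables.set_mask _ (eval_state ht) (eval_action₁ ht)
      (Term.eval_add (eval_moveSet ht) (y := S.weight (G.code q a b)) ?_)
    have hcode := eval_moveCode (B := B) (c := c) (G := G) (S := { S with
      sel := Function.update S.sel (q, a, G.code q a b) (b + 1) }) ht
    rw [Term.eval_cell, List.map_singleton, hcode]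
    rfl
  · rfl

theorem exec_register (ht : S.time = triple q a b) :
    register.exec B (G.toInput c) S.toMemory =
      (if (b : ℕ) + 1 = a₂ then S.register q a (k * n) else S).toMemory := by
  rw [register, Block.exec_ifEq (Term.eval_add (eval_action₂ ht) rfl) eval_numA₂]
  split_ifs
  · rw [Block.exec_ifEq (x := S.place (q, S.mask (q, a))) (y := 0)
      (by simp [eval_moveSet ht, eval_state ht, Tables.toMemory]) rfl, Tables.register]
    split_ifs
    · rw [Block.exec_seq, Tables.set_place S (eval_state ht) (eval_moveSet ht) eval_total,
        Tables.set_total _ (Term.eval_sub (Term.eval_mul (Term.eval_mul eval_numC eval_numQ)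
          eval_total) rfl)]
    · rfl
  · rfl

theorem exec_preprocess (ht : S.time = triple q a b) :
    preprocess.exec B (G.toInput c) S.toMemory =
      (if (b : ℕ) + 1 = a₂ then
        ((S.weigh (G.code q a b)).collect q a b (G.code q a b)).register q a (k * n)
      else (S.weigh (G.code q a b)).collect q a b (G.code q a b)).tick.toMemory := by
  have ht₁ := (Tables.time_weigh S (G.code q a b)).trans ht
  have ht₂ := (Tables.time_collect _ q a b (G.code q a b)).trans ht₁
  rw [preprocess, Block.exec_seq, Block.exec_seq, Block.exec_seq, exec_weigh ht, exec_collect ht₁,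
    exec_register ht₂]
  exact Tables.set_time _ (Term.eval_add eval_time rfl)

end Decider

/-! ### The invariant -/

/-- The tables after all triples with a number less than `S.time` have been processed. -/
structure Tables.Invariant (S : Tables 𝒞) (G : Game (Fin a₁) (Fin a₂) (Fin n) (Fin k)) : Prop where
  out : S.out = 0
  run : S.run = 0
  arr : S.arr = fun _ _ => .inl 0
  weight : ∃ D : Finset ℕ, D ⊆ Finset.range (k * n) ∧ IsNumbering 2 S.weight (S.pow + 1) D
  weight_ne : ∀ q a p, S.sel (q, a, p) ≠ 0 → S.weight p ≠ 0
  mask : ∀ q a, S.mask (q, a) = ∑ p ∈ Finset.range (k * n) with S.sel (q, a, p) ≠ 0, S.weight p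
  sel_ne : ∀ q a b, (triple q a b : ℕ) < S.time → S.sel (q, a, G.code q a b) ≠ 0
  sel_eq : ∀ (q : Fin n) (a : Fin a₁) p, S.sel (q, a, p) ≠ 0 →
    ∃ b : Fin a₂, S.sel (q, a, p) = b + 1 ∧ G.code q a b = p
  place : ∃ D : Finset (ℕ × ℕ), D ⊆ Finset.range n ×ˢ Finset.range (2 ^ (k * n)) ∧
    IsNumbering (k * n) S.place (S.total + 1) D ∧
    ∀ (q : Fin n) (a : Fin a₁), (∀ b : Fin a₂, (triple q a b : ℕ) < S.time) →
      ((q : ℕ), S.mask (q, a)) ∈ D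

namespace Tables.Invariant

variable {S : Tables 𝒞}

theorem mask_lt (h : S.Invariant G) (q a : ℕ) : S.mask (q, a) < 2 ^ (k * n) := by
  obtain ⟨D, hD, hnum⟩ := h.weight
  rw [h.mask]
  refine (hnum.sum_lt fun p hp => ?_).trans_le
    (Nat.pow_le_pow_right two_pos (by simpa using Finset.card_le_card hD))
  exact (hnum.mem_iff two_pos p).mpr (h.weight_ne q a p (Finset.mem_filter.mp hp).2)

theorem zero (ha₂ : 0 < a₂) : (Tables.zero 𝒞).Invariant G where
  out := rfl
  run := rfl
  arr := rfl
  weight := ⟨∅, by simp, IsNumbering.empty 2⟩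
  weight_ne _ _ _ h := absurd rfl h
  mask _ _ := by simp [Tables.zero]
  sel_ne _ _ _ h := absurd h (Nat.not_lt_zero _)
  sel_eq _ _ _ h := absurd rfl h
  place := ⟨∅, by simp, IsNumbering.empty _, fun _ _ h => absurd (h ⟨0, ha₂⟩) (Nat.not_lt_zero _)⟩

/-- A new weight leaves the masks unchanged, because every move collected so far already has a
non-zero weight. -/
theorem weigh (h : S.Invariant G) {p : ℕ} (hp : p < k * n) :
    (S.weigh p).Invariant G ∧ (S.weigh p).weight p ≠ 0 := by
  unfold Tables.weigh
  split_ifs with h0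
  swap
  · exact ⟨h, h0⟩
  have hupd : ∀ p', S.weight p' ≠ 0 → Function.update S.weight p (S.pow + 1) p' = S.weight p' := by
    intro p' hp'
    rw [Function.update_of_ne]
    rintro rfl
    exact hp' h0
  refine ⟨{ h with weight := ?_, weight_ne := ?_, mask := ?_ }, by simp⟩
  · obtain ⟨D, hD, hnum⟩ := h.weight
    have hpD : p ∉ D := fun hpD => (hnum.mem_iff two_pos p).mp hpD h0
    refine ⟨insert p D, ?_, ?_⟩
    · rw [Finset.insert_subset_iff]
      exact ⟨Finset.mem_range.mpr hp, hD⟩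
    · exact hnum.insert hpD
  · intro q a p' hp'
    have := h.weight_ne q a p' hp'
    simp only [hupd p' this]
    exact this
  · intro q a
    refine (h.mask q a).trans (Finset.sum_congr rfl fun p' hp' => ?_)
    exact (hupd p' (h.weight_ne q a p' (Finset.mem_filter.mp hp').2)).symm

theorem collect (h : S.Invariant G) {q : Fin n} {a : Fin a₁} {b : Fin a₂}
    (ht : S.time = triple q a b) (hw : S.weight (G.code q a b) ≠ 0) :
    (S.collect q a b (G.code q a b)).Invariant G ∧
      (S.collect q a b (G.code q a b)).sel (q, a, G.code q a b) ≠ 0 := by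
  unfold Tables.collect
  split_ifs with h0
  swap
  · exact ⟨h, h0⟩
  have hup : ∀ x, S.sel x ≠ 0 →
      Function.update S.sel ((q : ℕ), (a : ℕ), G.code q a b) ((b : ℕ) + 1) x ≠ 0 := by
    intro x hx
    rw [Function.update_apply]
    split_ifs
    · simp
    · exact hx
  refine ⟨{ h with weight_ne := ?_, mask := ?_, sel_ne := ?_, sel_eq := ?_, place := ?_ }, by simp⟩
  · intro q' a' p hp
    simp only [Function.update_apply] at hp
    split_ifs at hp with hc
    · simp only [Prod.mk.injEq] at hc
      exact hc.2.2 ▸ hw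
    · exact h.weight_ne q' a' p hp
  · intro q' a'
    simp only [Function.update_apply, Prod.mk.injEq]
    split_ifs with hc
    · obtain ⟨rfl, rfl⟩ := hc
      have : (Finset.range (k * n)).filter (fun p => (if (q : ℕ) = q ∧ (a : ℕ) = a ∧
          p = G.code q a b then (b : ℕ) + 1 else S.sel (q, a, p)) ≠ 0) =
          insert (G.code q a b) ((Finset.range (k * n)).filter fun p => S.sel (q, a, p) ≠ 0) := by
        ext p
        by_cases hp : p = G.code q a b
        · simp [hp, G.code_lt]
        · simp [hp]
      rw [this, Finset.sum_insert (by simp [h0]), h.mask, add_comm]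
    · rw [h.mask]
      refine Finset.sum_congr (Finset.filter_congr fun p _ => ?_) fun _ _ => rfl
      rw [if_neg fun h => hc ⟨h.1, h.2.1⟩]
  · exact fun q' a' b' hlt => hup _ (h.sel_ne q' a' b' hlt)
  · intro q' a' p hp
    simp only [Function.update_apply] at hp ⊢
    split_ifs at hp ⊢ with hc
    · simp only [Prod.mk.injEq] at hc
      obtain ⟨h₁, h₂, h₃⟩ := hc
      obtain rfl := Fin.ext h₁
      obtain rfl := Fin.ext h₂
      exact ⟨b, rfl, h₃.symm⟩
    · exact h.sel_eq q' a' p hp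
  · obtain ⟨D, hD, hnum, hmem⟩ := h.place
    refine ⟨D, hD, hnum, fun q' a' hlt => ?_⟩
    simp only [Function.update_apply, Prod.mk.injEq]
    split_ifs with hc
    · obtain rfl := Fin.ext hc.1
      obtain rfl := Fin.ext hc.2
      -- The mask changes only for the current state and action, whose triples have not all been
      -- processed.
      exact absurd (hlt b) (by simp [ht])
    · exact hmem q' a' hlt

theorem register (h : S.Invariant G) (q : Fin n) (a : Fin a₁) (hN : 0 < k * n) :
    (S.register q a (k * n)).Invariant G ∧
      (S.register q a (k * n)).place (q, (S.register q a (k * n)).mask (q, a)) ≠ 0 := by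
  unfold Tables.register
  split_ifs with h0
  swap
  · exact ⟨h, h0⟩
  refine ⟨{ h with place := ?_ }, by simp⟩
  obtain ⟨D, hD, hnum, hmem⟩ := h.place
  have hxD : ((q : ℕ), S.mask (q, a)) ∉ D := fun hx => (hnum.mem_iff hN _).mp hx h0
  refine ⟨insert ((q : ℕ), S.mask (q, a)) D, ?_, ?_, fun q' a' hlt =>
    Finset.mem_insert_of_mem (hmem q' a' hlt)⟩
  · rw [Finset.insert_subset_iff]
    exact ⟨by simp [h.mask_lt], hD⟩
  -- The next place value is stored minus one; restoring it is exact, since `N * (S.total + 1)` is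
  -- positive.
  · have := hnum.insert hxD
    rwa [← Nat.sub_add_cancel (Nat.one_le_iff_ne_zero.mpr
      (Nat.mul_pos hN (Nat.succ_pos S.total)).ne')] at this

theorem tick (h : S.Invariant G) {q : Fin n} {a : Fin a₁} {b : Fin a₂} (hN : 0 < k * n)
    (ht : S.time = triple q a b) (hsel : S.sel (q, a, G.code q a b) ≠ 0)
    (hplace : (b : ℕ) + 1 = a₂ → S.place (q, S.mask (q, a)) ≠ 0) : S.tick.Invariant G := by
  have heq : ∀ {q' a' b'}, (triple q' a' b' : ℕ) < S.time + 1 → ¬ (triple q' a' b' : ℕ) < S.time →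
      q' = q ∧ a' = a ∧ b' = b := by
    intro q' a' b' h₁ h₂
    rw [ht] at h₁ h₂
    exact triple_inj.mp (Fin.ext (by omega))
  refine { h with sel_ne := fun q' a' b' hlt => ?_, place := ?_ }
  · by_cases hlt' : (triple q' a' b' : ℕ) < S.time
    · exact h.sel_ne q' a' b' hlt'
    · obtain ⟨rfl, rfl, rfl⟩ := heq hlt hlt'
      exact hsel
  · obtain ⟨D, hD, hnum, hmem⟩ := h.place
    refine ⟨D, hD, hnum, fun q' a' hlt => ?_⟩
    by_cases hlt' : ∀ b' : Fin a₂, (triple q' a' b' : ℕ) < S.time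
    · exact hmem q' a' hlt'
    · push Not at hlt'
      obtain ⟨b', hb'⟩ := hlt'
      obtain ⟨rfl, rfl, rfl⟩ := heq (hlt b') hb'.not_gt
      refine (hnum.mem_iff hN _).mpr (hplace (le_antisymm b'.2 ?_))
      -- If `b'` were not the last action of Player 2, the triple with `b' + 1` would still be
      -- unprocessed after this step.
      by_contra hlast
      have h₁ := hlt ⟨b' + 1, not_le.mp hlast⟩
      have h₂ : S.tick.time = triple q' a' b' + 1 := by rw [← ht]; rfl
      rw [h₂, triple_val, triple_val] at h₁
      simp only at h₁
      omega

theorem step (h : S.Invariant G) {q : Fin n} {a : Fin a₁} {b : Fin a₂}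
    (ht : S.time = triple q a b) :
    (if (b : ℕ) + 1 = a₂ then
        ((S.weigh (G.code q a b)).collect q a b (G.code q a b)).register q a (k * n)
      else (S.weigh (G.code q a b)).collect q a b (G.code q a b)).tick.Invariant G := by
  have hN : 0 < k * n := (G.code_lt q a b).pos
  obtain ⟨h₁, hw⟩ := h.weigh (G.code_lt q a b)
  have ht₁ := (Tables.time_weigh S (G.code q a b)).trans ht
  obtain ⟨h₂, hsel⟩ := h₁.collect ht₁ hw
  have ht₂ := (Tables.time_collect _ q a b (G.code q a b)).trans ht₁
  split_ifs with hb
  · obtain ⟨h₃, hplace⟩ := h₂.register q a hN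
    refine h₃.tick hN (b := b) ?_ ?_ fun _ => hplace
    · rw [← ht₂, Tables.time_register]
    · unfold Tables.register
      split_ifs <;> exact hsel
  · exact h₂.tick hN ht₂ hsel fun h => absurd h hb

end Tables.Invariant

end Preprocessing

/-! ## Reading off the responses of Player 2 from the tables -/

section Responses

variable {𝒞 : Type*} {B : Primitives 𝒞} {a₁ a₂ n k : ℕ} {c : Fin k ↪ 𝒞}
  {G : Game (Fin a₁) (Fin a₂) (Fin n) (Fin k)}

namespace Tables

variable {S : Tables 𝒞}

/-- The action stored for the response in run `r` to the action `a` in the state `q`, where `N`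
is the number of possible moves. -/
def responseVal (S : Tables 𝒞) (N r q a : ℕ) : ℕ :=
  S.sel (q, a, r % (S.total + 1) / S.place (q, S.mask (q, a)) % N) - 1

/-- A digit may name a move that the action does not offer. The entry is then 0, and truncated
subtraction yields the legal action 0. -/
theorem Invariant.responseVal_lt (h : S.Invariant G) (ha₂ : 0 < a₂) (r : ℕ) (q : Fin n)
    (a : Fin a₁) : S.responseVal (k * n) r q a < a₂ := by
  unfold responseVal
  rcases Nat.eq_zero_or_pos
    (S.sel (q, a, r % (S.total + 1) / S.place (q, S.mask (q, a)) % (k * n))) with h0 | h0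
  · rwa [h0]
  · obtain ⟨b, hb, -⟩ := h.sel_eq q a _ h0.ne'
    rw [hb, Nat.add_sub_cancel]
    exact b.2

def Invariant.response (h : S.Invariant G) (ha₂ : 0 < a₂) (r : ℕ) (q : Fin n) (a : Fin a₁) :
    Fin a₂ :=
  ⟨S.responseVal (k * n) r q a, h.responseVal_lt ha₂ r q a⟩

/-- The number of runs per initial state is a power whose exponent counts the registered pairs of a
state and a mask; masks are below `2 ^ (k * n)`. -/
theorem Invariant.total_le (h : S.Invariant G) (hN : 0 < k * n) :
    S.total + 1 ≤ (k * n) ^ (n * 2 ^ (k * n)) := by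
  obtain ⟨D, hD, ⟨-, -, -, -, htotal⟩, -⟩ := h.place
  rw [htotal]
  exact Nat.pow_le_pow_right hN (by simpa using Finset.card_le_card hD)

theorem triple_lt_time (ht : S.time = n * a₁ * a₂) (q : Fin n) (a : Fin a₁) (b : Fin a₂) :
    (triple q a b : ℕ) < S.time := by
  rw [ht]
  exact (triple q a b).2

/-- The moves whose numbers are stored for an action determine the sum of their weights. -/
theorem Invariant.mask_eq [Nonempty (Fin a₂)] (h : S.Invariant G) (ht : S.time = n * a₁ * a₂)
    (q : Fin n) (a : Fin a₁) :
    S.mask (q, a) = ∑ p ∈ (G.moves q a).1.map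
      (finProdFinEquiv.toEmbedding.trans Fin.valEmbedding), S.weight p := by
  rw [h.mask]
  refine Finset.sum_congr (Finset.ext fun p => ?_) fun _ _ => rfl
  simp only [Finset.mem_filter, Finset.mem_range, Finset.mem_map, Game.mem_moves]
  constructor
  · rintro ⟨-, hp⟩
    obtain ⟨b, -, hb⟩ := h.sel_eq q a p hp
    exact ⟨_, ⟨b, rfl⟩, hb⟩
  · rintro ⟨_, ⟨b, rfl⟩, rfl⟩
    exact ⟨G.code_lt q a b, h.sel_ne q a b (triple_lt_time ht q a b)⟩

theorem Invariant.moves_eq_of_mask_eq [Nonempty (Fin a₂)] (h : S.Invariant G)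
    (ht : S.time = n * a₁ * a₂) {q q' : Fin n} {a a' : Fin a₁}
    (heq : S.mask (q, a) = S.mask (q', a')) : G.moves q a = G.moves q' a' := by
  obtain ⟨D, -, hnum⟩ := h.weight
  have hsub : ∀ (q : Fin n) (a : Fin a₁), (G.moves q a).1.map
      (finProdFinEquiv.toEmbedding.trans Fin.valEmbedding) ⊆ D := by
    intro q a p hp
    obtain ⟨e, he, rfl⟩ := Finset.mem_map.mp hp
    obtain ⟨b, rfl⟩ := Game.mem_moves.mp he
    exact (hnum.mem_iff two_pos _).mpr
      (h.weight_ne q a _ (h.sel_ne q a b (triple_lt_time ht q a b)))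
  rw [h.mask_eq ht, h.mask_eq ht] at heq
  exact Subtype.ext (Finset.map_injective _ (hnum.sum_injOn (hsub q a) (hsub q' a') heq))

/-- Given a choice `τ`, take the run number whose digit at the place of a state and a set of moves
is the code of the chosen move. -/
theorem Invariant.isRich_response (h : S.Invariant G) (ha₂ : 0 < a₂) [Nonempty (Fin a₂)]
    (ht : S.time = n * a₁ * a₂) :
    G.IsRich fun r : Fin (S.total + 1) => h.response ha₂ r := by
  classical
  intro τ hτ
  obtain ⟨D, hD, ⟨i, hi, hT, -, htotal⟩, hmem⟩ := h.place
  replace hmem : ∀ (q : Fin n) (a : Fin a₁), ((q : ℕ), S.mask (q, a)) ∈ D := fun q a =>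
    hmem q a fun b => triple_lt_time ht q a b
  rcases isEmpty_or_nonempty (Fin n × Fin a₁) with hempty | ⟨⟨q₁, a₁'⟩⟩
  · exact ⟨0, fun q a => hempty.elim (q, a)⟩
  let code : Fin n → Fin a₁ → Fin (k * n) := fun q a => finProdFinEquiv (τ q (G.moves q a))
  -- Digits are indexed by the exponents `i`, not by the place values, which all coincide when `k *
  -- n = 1`. Actions with equal masks share a digit, which is consistent because their sets of moves
  -- agree. Unused digits are arbitrary.
  let g : Fin D.card → Fin (k * n) := fun j =>
    if hj : ∃ z : Fin n × Fin a₁, i ((z.1 : ℕ), S.mask (z.1, z.2)) = j then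
      code hj.choose.1 hj.choose.2 else code q₁ a₁'
  have hg : ∀ (q : Fin n) (a : Fin a₁) (j : Fin D.card), i ((q : ℕ), S.mask (q, a)) = j →
      g j = code q a := by
    intro q a j hij
    have hj : ∃ z : Fin n × Fin a₁, i ((z.1 : ℕ), S.mask (z.1, z.2)) = j := ⟨(q, a), hij⟩
    simp only [g, dif_pos hj]
    have := hi (hmem _ _) (hmem _ _) (hj.choose_spec.trans hij.symm)
    rw [Prod.mk.injEq] at this
    have hq := Fin.ext this.1
    have hmoves := h.moves_eq_of_mask_eq ht this.2
    change finProdFinEquiv (τ hj.choose.1 _) = _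
    rw [hmoves, hq]
  refine ⟨Fin.cast htotal.symm (finFunctionFinEquiv g), fun q a => ?_⟩
  obtain ⟨hlt, hplace⟩ := hT _ (hmem q a)
  have hdigit : (finFunctionFinEquiv g : ℕ) % (S.total + 1) / S.place (q, S.mask (q, a)) %
      (k * n) = code q a := by
    rw [htotal, Nat.mod_eq_of_lt (finFunctionFinEquiv g).2, hplace, ← hg q a ⟨_, hlt⟩ rfl]
    conv_rhs => rw [← finFunctionFinEquiv.symm_apply_apply g]
    rw [finFunctionFinEquiv_symm_apply_val]
  obtain ⟨b, hb⟩ := Game.mem_moves.mp (hτ q (G.moves q a))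
  have hcode : G.code q a b = code q a := by
    simp only [Game.code, code, hb]
  have hsel := h.sel_ne q a b (triple_lt_time ht q a b)
  rw [hcode] at hsel
  obtain ⟨b', hb', hcode'⟩ := h.sel_eq q a _ hsel
  have hres : h.response ha₂ (finFunctionFinEquiv g) q a = b' := by
    apply Fin.ext
    simp only [response, responseVal, hdigit, hb', Nat.add_sub_cancel]
  simp only [Fin.val_cast, hres]
  rw [← hb]
  apply finProdFinEquiv.injective
  apply Fin.ext
  exact hcode'.trans hcode.symm

end Tables

theorem toFin?_eq_some {N : ℕ} {v : Value 𝒞} {x : Fin N} (h : toFin? N v = some x) :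
    v = .inl (x : ℕ) := by
  cases v with
  | inl y =>
    simp only [toFin?] at h
    split_ifs at h with hy
    simp only [Option.some.injEq] at h
    rw [← h]
  | inr y => simp [toFin?] at h

namespace Decider

theorem eval_response {S : Tables 𝒞} (h : S.Invariant G) (ha₂ : 0 < a₂) (r : ℕ) (m : Memory 𝒞)
    {x y : Term} {q : Fin n} {a : Fin a₁}
    (hx : x.eval B (G.toInput c) { S with run := r, arr := m }.toMemory = .inl q)
    (hy : y.eval B (G.toInput c) { S with run := r, arr := m }.toMemory = .inl a) :
    (response x y).eval B (G.toInput c) { S with run := r, arr := m }.toMemory =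
      .inl (h.response ha₂ r q a : ℕ) := by
  have hd : (digit x y).eval B (G.toInput c) { S with run := r, arr := m }.toMemory =
      .inl (r % (S.total + 1) / S.place (q, S.mask (q, a)) % (k * n)) :=
    Term.eval_mod (Term.eval_div (Term.eval_mod eval_run eval_total)
      (by simp [hx, hy, Tables.toMemory])) (Term.eval_mul eval_numC eval_numQ)
  refine Term.eval_sub (x := S.sel (q, a, r % (S.total + 1) / S.place (q, S.mask (q, a)) %
    (k * n))) ?_ rfl
  simp [hx, hy, hd, Tables.toMemory]

/-- Out-of-range arguments give 0 in both inputs, so the computed response matters only for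
arguments in range. -/
theorem simulates {S : Tables 𝒞} (h : S.Invariant G) (ha₂ : 0 < a₂) (r : ℕ) {start : Term}
    {q₀ : Fin n} (hstart : ∀ m, start.eval B (G.toInput c) { S with run := r, arr := m }.toMemory =
      .inl q₀) :
    Simulates B (G.toInput c) start { S with run := r }
      (((G.startAt q₀).against (h.response ha₂ r)).toInput c) := by
  intro m i l
  have hmove : ∀ x y : Term, ∀ q a,
      toFin? n (x.eval B (G.toInput c) { S with run := r, arr := m }.toMemory) = some q →
      toFin? a₁ (y.eval B (G.toInput c) { S with run := r, arr := m }.toMemory) = some a →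
      toFin? a₂ ((response x y).eval B (G.toInput c) { S with run := r, arr := m }.toMemory) =
        some (h.response ha₂ r q a) := by
    intro x y q a hq ha
    rw [eval_response h ha₂ r m (toFin?_eq_some hq) (toFin?_eq_some ha), toFin?_val]
  match i, l with
  | .numA₁, l => cases l <;> simp [simInput, Game.toInput, OnePlayerGame.toInput]
  | .numA₂, l => cases l <;> simp [simInput, OnePlayerGame.toInput]
  | .numQ, l => cases l <;> simp [simInput, Game.toInput, OnePlayerGame.toInput]
  | .numC, l => cases l <;> simp [simInput, Game.toInput, OnePlayerGame.toInput]
  | .start, [] => exact hstart m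
  | .start, x :: l => simp [simInput, OnePlayerGame.toInput]
  | .next, [] => simp [simInput, OnePlayerGame.toInput]
  | .next, [x] => simp [simInput, OnePlayerGame.toInput]
  | .next, [x, y] =>
    simp only [simInput, Term.eval_entry, List.map_cons, List.map_nil, Game.toInput,
      OnePlayerGame.toInput]
    rcases hq : toFin? n (x.eval B (G.toInput c) { S with run := r, arr := m }.toMemory) with _ | q
    · simp only [hq]
    rcases ha : toFin? a₁ (y.eval B (G.toInput c) { S with run := r, arr := m }.toMemory) with _ | a
    · simp only [hq, ha]
    · simp only [hmove x y q a hq ha, hq, ha]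
      rfl
  | .next, x :: y :: z :: l => simp [simInput, OnePlayerGame.toInput]
  | .col, [] => simp [simInput, OnePlayerGame.toInput]
  | .col, [x] => simp [simInput, OnePlayerGame.toInput]
  | .col, [x, y] =>
    simp only [simInput, Term.eval_entry, List.map_cons, List.map_nil, Game.toInput,
      OnePlayerGame.toInput]
    rcases hq : toFin? n (x.eval B (G.toInput c) { S with run := r, arr := m }.toMemory) with _ | q
    · simp only [hq]
    rcases ha : toFin? a₁ (y.eval B (G.toInput c) { S with run := r, arr := m }.toMemory) with _ | a
    · simp only [hq, ha]
    · simp only [hmove x y q a hq ha, hq, ha]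
      rfl
  | .col, x :: y :: z :: l => simp [simInput, OnePlayerGame.toInput]
  | .color, [] => simp [simInput, Game.toInput, OnePlayerGame.toInput]
  | .color, [x] => simp [simInput, Game.toInput, OnePlayerGame.toInput]
  | .color, x :: y :: l => simp [simInput, Game.toInput, OnePlayerGame.toInput]

end Decider

end Responses

/-! ## The deciding program -/

section Iteration

variable {𝒞 : Type*}

/-- Iterating `E` from `m` produces an answer after at most `T` steps, which is "yes" iff `p`. -/
def DecidesFrom (E : Memory 𝒞 → Memory 𝒞) (m : Memory 𝒞) (p : Prop) (T : ℕ) : Prop :=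
  ∃ t ≤ T, (∀ u < t, E^[u] m 0 [] = .inl 0) ∧ E^[t] m 0 [] ≠ .inl 0 ∧ (E^[t] m 0 [] = .inl 1 ↔ p)

theorem DecidesFrom.congr {E : Memory 𝒞 → Memory 𝒞} {m : Memory 𝒞} {p p' : Prop} {T : ℕ}
    (h : DecidesFrom E m p T) (hp : p ↔ p') : DecidesFrom E m p' T := by
  rwa [← propext hp]

theorem DecidesFrom.of_iterate {E : Memory 𝒞 → Memory 𝒞} {m : Memory 𝒞} {p : Prop} {j T T' : ℕ}
    (hj : ∀ u < j, E^[u] m 0 [] = .inl 0) (h : DecidesFrom E (E^[j] m) p T) (hT : j + T ≤ T') :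
    DecidesFrom E m p T' := by
  obtain ⟨t, ht, hlt, h₁, h₂⟩ := h
  have hadd : ∀ u, E^[u] (E^[j] m) = E^[u + j] m := fun u => (Function.iterate_add_apply E u j m).symm
  refine ⟨t + j, by omega, fun u hu => ?_, by rwa [← hadd], by rwa [← hadd]⟩
  rcases lt_or_ge u j with huj | huj
  · exact hj u huj
  · obtain ⟨v, rfl⟩ := Nat.exists_eq_add_of_le' huj
    rw [← hadd]
    exact hlt v (by omega)

end Iteration

namespace Decider

/-- If the simulated program has halted, pass to the next run or give the final answer. -/
def finish (runs : Term) : Block :=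
  .ifEq (.cell 9 [run]) (.const 0) .skip
    (.ifEq (.cell 9 [run]) (.const 1)
      (.ifEq (run.add (.const 1)) runs (.set 0 [] (.const 1)) (.set 1 [] (run.add (.const 1))))
      (.set 0 [] (.const 2)))

/-- The program that simulates `P` on `runs` one-player games with initial states `start`. -/
def program (start runs : Term) (P : Block) : Block :=
  .ifEq time ((numQ.mul numA₁).mul numA₂) (.seq (simBlock start P) (finish runs)) preprocess

variable {𝒞 : Type*} {B : Primitives 𝒞} {a₁ a₂ n k : ℕ} {c : Fin k ↪ 𝒞}
  {G : Game (Fin a₁) (Fin a₂) (Fin n) (Fin k)} {S : Tables 𝒞} {start runs : Term} {P : Block}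
  {R r : ℕ}

theorem exec_program_of_time_eq (ht : S.time = n * a₁ * a₂) :
    (program start runs P).exec B (G.toInput c) S.toMemory =
      (finish runs).exec B (G.toInput c) ((simBlock start P).exec B (G.toInput c) S.toMemory) := by
  rw [program, Block.exec_ifEq eval_time
    (Term.eval_mul (Term.eval_mul eval_numQ eval_numA₁) eval_numA₂), if_pos ht, Block.exec_seq]

theorem exec_finish {m m' : Memory 𝒞}
    (hruns : ∀ m, runs.eval B (G.toInput c) { S with run := r, arr := m }.toMemory = .inl R) :
    (m' 0 [] = .inl 0 → (finish runs).exec B (G.toInput c)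
      { S with run := r, arr := overlay r m m' }.toMemory =
        { S with run := r, arr := overlay r m m' }.toMemory) ∧
    (m' 0 [] = .inl 1 → (finish runs).exec B (G.toInput c)
      { S with run := r, arr := overlay r m m' }.toMemory =
        (if r + 1 = R then { S with run := r, arr := overlay r m m', out := 1 }
          else { S with run := r + 1, arr := overlay r m m' }).toMemory) ∧
    (m' 0 [] ≠ .inl 0 → m' 0 [] ≠ .inl 1 → (finish runs).exec B (G.toInput c)
      { S with run := r, arr := overlay r m m' }.toMemory =
        { S with run := r, arr := overlay r m m', out := 2 }.toMemory) := by
  have hcell : (Term.cell 9 [run]).eval B (G.toInput c)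
      { S with run := r, arr := overlay r m m' }.toMemory = m' 0 [] := by
    simp [eval_run, Tables.toMemory, overlay]
  refine ⟨fun h => ?_, fun h => ?_, fun h h' => ?_⟩
  · rw [finish, Block.exec_ifEq (hcell.trans h) rfl, if_pos rfl]
    rfl
  · rw [finish, Block.exec_ifEq (hcell.trans h) rfl, if_neg one_ne_zero,
      Block.exec_ifEq (hcell.trans h) rfl, if_pos rfl,
      Block.exec_ifEq (Term.eval_add eval_run rfl) (hruns _)]
    split_ifs
    · exact Tables.set_out _ rfl
    · exact Tables.set_run _ (Term.eval_add eval_run rfl)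
  · rw [finish, Block.exec, if_neg (by rw [hcell]; exact h), Block.exec,
      if_neg (by rw [hcell]; exact h')]
    exact Tables.set_out _ rfl

theorem overlay_eq_self {m : Memory 𝒞} (hm : ∀ y l, m y (.inl r :: l) = .inl 0) :
    overlay r m (fun _ _ => .inl 0) = m := by
  funext y l
  cases l with
  | nil => rfl
  | cons v l =>
    simp only [overlay]
    split_ifs with hv
    · rw [hv, hm]
    · rfl

/-- Induction on the number `d` of runs that remain after run `r`. A run costs at most `F` steps,
including the passage to the next one; a "no" ends everything at once, and a "yes" in the last run
is the final "yes". -/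
theorem decidesFrom_run {I' : ℕ → Input 𝒞} {win : ℕ → Prop} {F : ℕ} (hout : S.out = 0)
    (ht : S.time = n * a₁ * a₂)
    (hruns : ∀ r m, runs.eval B (G.toInput c) { S with run := r, arr := m }.toMemory = .inl R)
    (hsim : ∀ r < R, Simulates B (G.toInput c) start { S with run := r } (I' r))
    (hP : ∀ r < R, P.Decides B (I' r) (win r) F) (d r : ℕ) (hr : r + d + 1 = R) (m : Memory 𝒞)
    (hm : ∀ r' ≥ r, ∀ y l, m y (.inl r' :: l) = .inl 0) :
    DecidesFrom ((program start runs P).exec B (G.toInput c)) { S with run := r, arr := m }.toMemory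
      (∀ r' ≥ r, r' < R → win r') ((d + 1) * F) := by
  induction d generalizing r m with
  | zero | succ d ih =>
    have hrR : r < R := by omega
    obtain ⟨t, htF, hlt, hne, hiff⟩ := hP r hrR
    -- The simulated output cell is 0 initially, so halting takes at least one step. The last one is
    -- treated separately, since `finish` acts in it.
    obtain ⟨s, rfl⟩ : ∃ s, t = s + 1 :=
      Nat.exists_eq_succ_of_ne_zero fun h => hne (by rw [h]; rfl)
    have hexec : ∀ m', (program start runs P).exec B (G.toInput c)
        { S with run := r, arr := overlay r m m' }.toMemory = (finish runs).exec B (G.toInput c)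
          { S with run := r, arr := overlay r m (P.exec B (I' r) m') }.toMemory := fun m' => by
      rw [exec_program_of_time_eq (S := { S with run := r, arr := overlay r m m' }) ht]
      exact congrArg _ (exec_simBlock (S := { S with run := r }) (hsim r hrR) P m m')
    have hstep : ∀ u, P.run B (I' r) (u + 1) = P.exec B (I' r) (P.run B (I' r) u) := fun u =>
      Function.iterate_succ_apply' _ _ _
    have hiter : ∀ u ≤ s, ((program start runs P).exec B (G.toInput c))^[u]
        { S with run := r, arr := m }.toMemory =
          { S with run := r, arr := overlay r m (P.run B (I' r) u) }.toMemory := by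
      intro u hu
      induction u with
      | zero =>
        change _ = { S with run := r, arr := overlay r m fun _ _ => .inl 0 }.toMemory
        rw [overlay_eq_self (hm r le_rfl)]
        rfl
      | succ u ihu =>
        rw [Function.iterate_succ_apply', ihu (by omega), hexec, ← hstep]
        exact (exec_finish (hruns r)).1 (hlt (u + 1) (by omega))
    have hzero : ∀ u < s + 1, ((program start runs P).exec B (G.toInput c))^[u]
        { S with run := r, arr := m }.toMemory 0 [] = .inl 0 := fun u hu => by
      rw [hiter u (by omega)]
      simp [Tables.toMemory, hout]
    have hlast : ((program start runs P).exec B (G.toInput c))^[s + 1]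
        { S with run := r, arr := m }.toMemory = (finish runs).exec B (G.toInput c)
          { S with run := r, arr := overlay r m (P.run B (I' r) (s + 1)) }.toMemory := by
      rw [Function.iterate_succ_apply', hiter s le_rfl, hexec, ← hstep]
    by_cases hwin : win r
    · have h1 := hiff.mpr hwin
      rw [(exec_finish (hruns r)).2.1 h1] at hlast
      first
      | rw [if_pos (by omega)] at hlast
        refine DecidesFrom.of_iterate (T := 0) hzero ?_ (by omega)
        rw [hlast]
        refine ⟨0, le_rfl, by simp, by simp [Tables.toMemory], ?_⟩
        simp only [Function.iterate_zero, id, Tables.toMemory, true_iff]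
        intro r' h₁ h₂
        obtain rfl : r' = r := by omega
        exact hwin
      | rw [if_neg (by omega)] at hlast
        refine DecidesFrom.of_iterate hzero (T := (d + 1) * F) ?_ (by rw [add_mul (d + 1)]; omega)
        rw [hlast]
        have := ih (r + 1) (by omega) (overlay r m (P.run B (I' r) (s + 1))) fun r' hr' y l => by
          simp only [overlay]
          rw [if_neg (by simp only [Sum.inl.injEq]; omega)]
          exact hm r' (by omega) y l
        refine this.congr ⟨fun h r' h₁ h₂ => ?_, fun h r' h₁ h₂ => h r' (by omega) h₂⟩
        rcases h₁.eq_or_lt with rfl | h₁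
        · exact hwin
        · exact h r' h₁ h₂
    · rw [(exec_finish (hruns r)).2.2 hne fun h => hwin (hiff.mp h)] at hlast
      refine DecidesFrom.of_iterate (T := 0) hzero ?_ (by first | omega | (rw [add_mul]; omega))
      rw [hlast]
      refine ⟨0, le_rfl, by simp, by simp [Tables.toMemory], ?_⟩
      simp only [Function.iterate_zero, id, Tables.toMemory, Sum.inl.injEq, OfNat.ofNat_ne_one,
        false_iff]
      exact fun h => hwin (h r le_rfl hrR)

/-- Step `t` processes the triple with number `t`, as long as the counter is below `n * a₁ * a₂`. -/
theorem exists_tables (ha₂ : 0 < a₂) (t : ℕ) (ht : t ≤ n * a₁ * a₂) :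
    ∃ S : Tables 𝒞, S.Invariant G ∧ S.time = t ∧
      ((program start runs P).exec B (G.toInput c))^[t] (fun _ _ => .inl 0) = S.toMemory := by
  induction t with
  | zero => exact ⟨Tables.zero 𝒞, Tables.Invariant.zero ha₂, rfl, Tables.toMemory_zero.symm⟩
  | succ t ih =>
    obtain ⟨S, hS, htime, hiter⟩ := ih (by omega)
    obtain ⟨q, a, b, hqab⟩ := triple_surjective (⟨t, ht⟩ : Fin (n * a₁ * a₂))
    have htime' : S.time = triple q a b := by rw [htime, hqab]
    refine ⟨_, hS.step htime', ?_, ?_⟩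
    · change Tables.time (if _ then _ else _) + 1 = t + 1
      rw [← htime]
      split_ifs
      · rw [Tables.time_register, Tables.time_collect, Tables.time_weigh]
      · rw [Tables.time_collect, Tables.time_weigh]
    · rw [Function.iterate_succ_apply', hiter, ← exec_preprocess htime', program,
        Block.exec_ifEq eval_time (Term.eval_mul (Term.eval_mul eval_numQ eval_numA₁) eval_numA₂),
        if_neg (by omega)]

/-- The program decides whether all one-player games that it runs through are won. -/
theorem decides_program {K F : ℕ} (ha₁ : 0 < a₁) (ha₂ : 0 < a₂) (hK : 0 < K) {q₀ : ℕ → ℕ → Fin n}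
    {win : OnePlayerGame (Fin a₁) (Fin n) (Fin k) → Prop} {p : Prop}
    (hruns : ∀ (S : Tables 𝒞), runs.eval B (G.toInput c) S.toMemory = .inl (K * (S.total + 1)))
    (hstart : ∀ (S : Tables 𝒞), S.run < K * (S.total + 1) →
      start.eval B (G.toInput c) S.toMemory = .inl (q₀ (S.total + 1) S.run : ℕ))
    (hP : ∀ G', P.Decides B (OnePlayerGame.toInput G' c) (win G') F)
    (hp : ∀ (S : Tables 𝒞) (hS : S.Invariant G), S.time = n * a₁ * a₂ →
      ((∀ r < K * (S.total + 1),
        win ((G.startAt (q₀ (S.total + 1) r)).against (hS.response ha₂ r))) ↔ p)) :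
    (program start runs P).Decides B (G.toInput c) p
      (K * F * (k * n) ^ (n * 2 ^ (k * n)) + n * a₁ * a₂) := by
  -- These are the completed tables; `K` counts the initial states to be tested, and each needs
  -- `S.total + 1` runs.
  obtain ⟨S, hS, htime, hiter⟩ := exists_tables (B := B) (c := c) (G := G) (start := start)
    (runs := runs) (P := P) ha₂ _ le_rfl
  obtain ⟨d, hd⟩ : ∃ d, d + 1 = K * (S.total + 1) :=
    ⟨_, Nat.sub_add_cancel (Nat.mul_pos hK (Nat.succ_pos _))⟩
  have hN : 0 < k * n := (G.code_lt G.init ⟨0, ha₁⟩ ⟨0, ha₂⟩).pos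
  have key := decidesFrom_run (B := B) (c := c) (G := G) (S := S) (start := start) (runs := runs)
    (P := P) (R := K * (S.total + 1)) (F := F)
    (win := fun r => win ((G.startAt (q₀ (S.total + 1) r)).against (hS.response ha₂ r)))
    hS.out htime (fun r m => hruns { S with run := r, arr := m })
    (fun r hr => simulates hS ha₂ r fun m => hstart { S with run := r, arr := m } hr)
    (fun r _ => hP _) d 0 (by omega) S.arr (fun _ _ _ _ => by rw [hS.arr])
  rw [show { S with run := 0, arr := S.arr } = S by rw [← hS.run]] at key
  rw [← hiter] at key
  replace key := key.congr (p' := p) (by simpa using hp S hS htime)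
  refine DecidesFrom.of_iterate (fun u hu => ?_) key ?_
  · obtain ⟨S', hS', -, hiter'⟩ := exists_tables (B := B) (c := c) (G := G) (start := start)
      (runs := runs) (P := P) ha₂ u hu.le
    rw [hiter']
    simp [Tables.toMemory, hS'.out]
  · rw [hd, add_comm, mul_right_comm K F]
    have := Nat.mul_le_mul_right F (Nat.mul_le_mul_left K (hS.total_le hN))
    omega

end Decider

/-! ## The main theorem -/

theorem Game.winsWith_true {A₁ A₂ Q C : Type*} (G : Game A₁ A₂ Q C) (W : Set (ℕ → C)) :
    G.WinsWith True W ↔ G.WinsFM W := by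
  simp [Game.WinsWith, Game.WinsFM]

theorem Game.winsWith_false {A₁ A₂ Q C : Type*} (G : Game A₁ A₂ Q C) (W : Set (ℕ → C)) :
    G.WinsWith False W ↔ G.Wins W := by
  simp [Game.WinsWith, Game.Wins]

theorem OnePlayerGame.winsWith_true {A Q C : Type*} (G : OnePlayerGame A Q C) (W : Set (ℕ → C)) :
    G.WinsWith True W ↔ G.WinsFM W := by
  simp [OnePlayerGame.WinsWith, OnePlayerGame.WinsFM]

theorem OnePlayerGame.winsWith_false {A Q C : Type*} (G : OnePlayerGame A Q C) (W : Set (ℕ → C)) :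
    G.WinsWith False W ↔ G.Wins W := by
  simp [OnePlayerGame.WinsWith, OnePlayerGame.Wins]

section Main

open Decider

variable {𝒞 : Type*} {B : Primitives 𝒞} {W : Set (ℕ → 𝒞)} {f : ℕ → ℕ → ℕ → ℕ} {fm : Prop}
  {P : Block}

theorem decides_winsWith (hW : ClosedUnderInterleaving W) (hW' : ClosedUnderPrefixRemoval W)
    (hP : ∀ (a n k : ℕ) (_ : 0 < a) (c : Fin k ↪ 𝒞) (G : OnePlayerGame (Fin a) (Fin n) (Fin k)),
      P.Decides B (G.toInput c) (G.WinsWith fm (restrictTo c W)) (f a n k))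
    (a₁ a₂ n k : ℕ) (ha₁ : 0 < a₁) (ha₂ : 0 < a₂) (c : Fin k ↪ 𝒞)
    (G : Game (Fin a₁) (Fin a₂) (Fin n) (Fin k)) :
    (program (.entry .start []) total P).Decides B (G.toInput c) (G.WinsWith fm (restrictTo c W))
      (f a₁ n k * (k * n) ^ (n * 2 ^ (k * n)) + n * a₁ * a₂) := by
  have : Nonempty (Fin a₂) := ⟨⟨0, ha₂⟩⟩
  rw [← one_mul (f a₁ n k)]
  refine decides_program ha₁ ha₂ one_pos (q₀ := fun _ _ => G.init)
    (win := fun G' => G'.WinsWith fm (restrictTo c W)) (fun S => by rw [one_mul, eval_total])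
    (fun S _ => rfl) (hP a₁ n k ha₁ c) fun S hS ht => ?_
  rw [← Game.winsWith_iff_of_isRich (hW.restrictTo c) (hW'.restrictTo c) G
    (hS.isRich_response ha₂ ht), one_mul]
  exact ⟨fun h i => h i i.2, fun h r hr => h ⟨r, hr⟩⟩

/-- The quotient of the run number by the number of responses selects the initial state, and the
remainder selects the response. -/
theorem decides_forall_winsWith (hW : ClosedUnderInterleaving W)
    (hP : ∀ (a n k : ℕ) (_ : 0 < a) (c : Fin k ↪ 𝒞) (G : OnePlayerGame (Fin a) (Fin n) (Fin k)),
      P.Decides B (G.toInput c) (G.WinsWith fm (restrictTo c W)) (f a n k))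
    (a₁ a₂ n k : ℕ) (ha₁ : 0 < a₁) (ha₂ : 0 < a₂) (c : Fin k ↪ 𝒞)
    (G : Game (Fin a₁) (Fin a₂) (Fin n) (Fin k)) :
    (program (run.div total) (numQ.mul total) P).Decides B (G.toInput c)
      (∀ q, (G.startAt q).WinsWith fm (restrictTo c W))
      (n * f a₁ n k * (k * n) ^ (n * 2 ^ (k * n)) + n * a₁ * a₂) := by
  have : Nonempty (Fin a₂) := ⟨⟨0, ha₂⟩⟩
  have hn : 0 < n := G.init.pos
  refine decides_program ha₁ ha₂ hn
    (q₀ := fun R r => if h : r / R < n then ⟨r / R, h⟩ else G.init)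
    (win := fun G' => G'.WinsWith fm (restrictTo c W))
    (fun S => Term.eval_mul eval_numQ eval_total) (fun S hr => ?_) (hP a₁ n k ha₁ c)
    fun S hS ht => ?_
  · rw [dif_pos (Nat.div_lt_of_lt_mul (by rwa [mul_comm] at hr))]
    exact Term.eval_div eval_run eval_total
  · rw [← Game.forall_winsWith_iff_of_isRich (hW.restrictTo c) G (hS.isRich_response ha₂ ht)]
    constructor
    · intro h q i
      have hdiv : ((S.total + 1) * q + i) / (S.total + 1) = (q : ℕ) := by
        rw [Nat.mul_add_div (Nat.succ_pos _), Nat.div_eq_of_lt i.2, Nat.add_zero]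
      have hres : hS.response ha₂ ((S.total + 1) * q + i) = hS.response ha₂ i := by
        funext q' a
        apply Fin.ext
        simp only [Tables.Invariant.response, Tables.responseVal, Nat.mul_add_mod_self_left]
      have := h ((S.total + 1) * q + i) (by
        calc (S.total + 1) * q + i < (S.total + 1) * (q + 1) := by
              rw [mul_add_one]; exact Nat.add_lt_add_left i.2 _
          _ ≤ (S.total + 1) * n := Nat.mul_le_mul_left _ q.2
          _ = n * (S.total + 1) := mul_comm _ _)
      simpa only [hdiv, hres, Fin.is_lt, dite_true] using this
    · intro h r _
      have hres : hS.response ha₂ r =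
          hS.response ha₂ (⟨r % (S.total + 1), Nat.mod_lt _ (Nat.succ_pos _)⟩ :
            Fin (S.total + 1)) := by
        funext q' a
        apply Fin.ext
        simp only [Tables.Invariant.response, Tables.responseVal, Nat.mod_mod]
      rw [hres]
      exact h _ _

end Main

theorem mainTheorem8 {𝒞 : Type*} (B : Primitives 𝒞) (W : Set (ℕ → 𝒞))
    (hW : ClosedUnderInterleaving W) (f : ℕ → ℕ → ℕ → ℕ) :
    -- existence of a winning strategy
    (∀ P : Block, DecidesOnePlayer B W f P →
      (ClosedUnderPrefixRemoval W →
        ∃ P' : Block, ∀ (a₁ a₂ n k : ℕ) (_ : 0 < a₁) (_ : 0 < a₂) (c : Fin k ↪ 𝒞)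
          (G : Game (Fin a₁) (Fin a₂) (Fin n) (Fin k)),
          P'.Decides B (G.toInput c) (G.Wins (restrictTo c W))
            (f a₁ n k * (k * n) ^ (n * 2 ^ (k * n)) + n * a₁ * a₂)) ∧
      (∃ P' : Block, ∀ (a₁ a₂ n k : ℕ) (_ : 0 < a₁) (_ : 0 < a₂) (c : Fin k ↪ 𝒞)
          (G : Game (Fin a₁) (Fin a₂) (Fin n) (Fin k)),
          P'.Decides B (G.toInput c) (∀ q, (G.startAt q).Wins (restrictTo c W))
            (n * f a₁ n k * (k * n) ^ (n * 2 ^ (k * n)) + n * a₁ * a₂))) ∧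
    -- existence of a finite-memory winning strategy
    (∀ P : Block, DecidesOnePlayerFM B W f P →
      (ClosedUnderPrefixRemoval W →
        ∃ P' : Block, ∀ (a₁ a₂ n k : ℕ) (_ : 0 < a₁) (_ : 0 < a₂) (c : Fin k ↪ 𝒞)
          (G : Game (Fin a₁) (Fin a₂) (Fin n) (Fin k)),
          P'.Decides B (G.toInput c) (G.WinsFM (restrictTo c W))
            (f a₁ n k * (k * n) ^ (n * 2 ^ (k * n)) + n * a₁ * a₂)) ∧
      (∃ P' : Block, ∀ (a₁ a₂ n k : ℕ) (_ : 0 < a₁) (_ : 0 < a₂) (c : Fin k ↪ 𝒞)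
          (G : Game (Fin a₁) (Fin a₂) (Fin n) (Fin k)),
          P'.Decides B (G.toInput c) (∀ q, (G.startAt q).WinsFM (restrictTo c W))
            (n * f a₁ n k * (k * n) ^ (n * 2 ^ (k * n)) + n * a₁ * a₂))) := by
  refine ⟨fun P hP => ⟨fun hW' =>
      ⟨Decider.program (.entry .start []) Decider.total P, fun a₁ a₂ n k ha₁ ha₂ c G => ?_⟩,
    ⟨Decider.program (Decider.run.div Decider.total) (Decider.numQ.mul Decider.total) P,
      fun a₁ a₂ n k ha₁ ha₂ c G => ?_⟩⟩,
    fun P hP => ⟨fun hW' =>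
      ⟨Decider.program (.entry .start []) Decider.total P, fun a₁ a₂ n k ha₁ ha₂ c G => ?_⟩,
    ⟨Decider.program (Decider.run.div Decider.total) (Decider.numQ.mul Decider.total) P,
      fun a₁ a₂ n k ha₁ ha₂ c G => ?_⟩⟩⟩
  · simp only [← Game.winsWith_false]
    refine decides_winsWith (P := P) hW hW' (fun a n k ha c G => ?_) a₁ a₂ n k ha₁ ha₂ c G
    simpa only [OnePlayerGame.winsWith_false] using hP a n k ha c G
  · simp only [← Game.winsWith_false]
    refine decides_forall_winsWith (P := P) hW (fun a n k ha c G => ?_) a₁ a₂ n k ha₁ ha₂ c G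
    simpa only [OnePlayerGame.winsWith_false] using hP a n k ha c G
  · simp only [← Game.winsWith_true]
    refine decides_winsWith (P := P) hW hW' (fun a n k ha c G => ?_) a₁ a₂ n k ha₁ ha₂ c G
    simpa only [OnePlayerGame.winsWith_true] using hP a n k ha c G
  · simp only [← Game.winsWith_true]
    refine decides_forall_winsWith (P := P) hW (fun a n k ha c G => ?_) a₁ a₂ n k ha₁ ha₂ c G
    simpa only [OnePlayerGame.winsWith_true] using hP a n k ha c G
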